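/- Let $\Gamma$ be a commutative cancellative monoid (written additively) whose quotient group is torsion-free, let $R=\bigoplus_{\alpha\in\Gamma}R_\alpha$ be a $\Gamma$-graded integral domain with quotient field $K$, and assume that $R$ contains a unit that is homogeneous of nonzero degree. Let $H$ be the set of nonzero homogeneous elements of $R$, so that $R\subseteq R_H\subseteq K$, and for $f\in R$ let $C(f)$ be the ideal of $R$ generated by the homogeneous components of $f$. A semistar operation on $R$ is a map $E\mapsto E^\star$ from the set of nonzero $R$-submodules of $K$ to itself such that, for all such $E,F$ and all $0\ne x\in K$: $(xE)^\star=xE^\star$; $E\subseteq F$ implies $E^\star\subseteq F^\star$; $E\subseteq E^\star=(E^\star)^\star$. Write $f(R)$ for the set of nonzero finitely generated $R$-submodules of $K$. Associated to $\star$ are $$E^{\star_f}=\bigcup\{F^\star\mid F\in f(R),\,F\subseteq E\},\qquad E^{\widetilde\star}=\{x\in K\mid xJ\subseteq E\text{ for some }J\in f(R),\ J\subseteq R,\ J^\star=R^\star\},$$ $$F^{\star_a}=\bigcup\{((FG)^\star:G^\star)\mid G\in f(R)\}\ \ (F\in f(R)),\qquad E^{\star_a}=\bigcup\{F^{\star_a}\mid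 F\in f(R),\,F\subseteq E\},$$ where $(A:B)=\{x\in K\mid xB\subseteq A\}$; the map $\widetilde\star$ is again a semistar operation, and $\widetilde\star_a$ denotes $(\widetilde\star)_a$. Let $\star$ be a semistar operation on $R$ with $R^\star\subsetneq R_H$. Put $N_\star(H)=\{f\in R\mid f\neq0,\ C(f)^\star=R^\star\}$, which is a multiplicative subset of $R$, and $$\mathrm{Kr}(R,\widetilde\star)=\Big\{\tfrac fg\in K\ \Big|\ f,g\in R,\ g\neq0,\ C(f)C(h)\subseteq(C(g)C(h))^{\widetilde\star}\text{ for some }0\ne h\in R\Big\}.$$ Then $\mathrm{Kr}(R,\widetilde\star)$ is a subring of $K$ containing $R$, and the following statements are equivalent: 1. $R$ is a graded P$\star$MD, i.e. $(II^{-1})^{\star_f}=R^\star$ for every nonzero finitely generated homogeneous ideal $I$ of $R$, where $I^{-1}=(R:I)$. 2. Every ideal of $R_{N_\star(H)}$ is extended from a homogeneous ideal of $R$. 3. Every principal ideal of $R_{N_\star(H)}$ is extended from a homogeneous ideal of $R$. 4. $R_{N_\star(H)}$ is a Prüfer domain. 5. $R_{N_\star(H)}$ is a Bézout domain. 6. $R_{N_\star(H)}=\mathrm{Kr}(R,\widetilde\star)$.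 7. $\mathrm{Kr}(R,\widetilde\star)$ is a quotient ring of $R$, i.e. equal to $R_S$ for some multiplicative subset $S$ of $R$. 8. $\mathrm{Kr}(R,\widetilde\star)$ is a flat $R$-module. 9. $I^{\widetilde\star}=I^{\widetilde\star_a}$ for every nonzero finitely generated homogeneous ideal $I$ of $R$. Moreover, if $R$ is a graded P$\star$MD, then $R^{\widetilde\star}$ is integrally closed. -/

import Mathlib

open scoped Pointwise nonZeroDivisors

/-! ### Semistar operations -/

/-- A semistar operation on a domain `R` with quotient field `K`. It acts on the nonzero
`R`-submodules of `K`; it is extended to all submodules by `0 ↦ 0`, and with this convention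
(which every semistar operation satisfies in exactly one way) the axioms hold for all
submodules. -/
structure SemistarOperation (R K : Type*) [CommRing R] [Field K] [Algebra R K] where
  /-- the map `E ↦ E^⋆` -/
  toFun : Submodule R K → Submodule R K
  bot' : toFun ⊥ = ⊥
  smul' : ∀ (x : K), x ≠ 0 → ∀ E : Submodule R K, toFun (x • E) = x • toFun E
  mono' : ∀ E F : Submodule R K, E ≤ F → toFun E ≤ toFun F
  le' : ∀ E : Submodule R K, E ≤ toFun E
  idem' : ∀ E : Submodule R K, toFun (toFun E) = toFun E

namespace SemistarOperation

variable {R K : Type*} [CommRing R] [Field K] [Algebra R K]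

instance : CoeFun (SemistarOperation R K) (fun _ => Submodule R K → Submodule R K) :=
  ⟨SemistarOperation.toFun⟩

theorem mem_smul_iff {x : K} (hx : x ≠ 0) (E : Submodule R K) (y : K) :
    y ∈ x • E ↔ x⁻¹ * y ∈ E := by
  constructor
  · rintro ⟨z, hz, rfl⟩
    simpa [hx] using hz
  · intro h
    have := Submodule.smul_mem_pointwise_smul _ x E h
    simpa [hx] using this

theorem mul_le (s : SemistarOperation R K) (E F : Submodule R K) : E * s F ≤ s (E * F) := by
  rw [Submodule.mul_le]
  intro e he y hy
  by_cases h0 : e = 0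
  · simp [h0]
  · have h1 : e * y ∈ e • s F := Submodule.smul_mem_pointwise_smul _ e _ hy
    rw [← s.smul' e h0] at h1
    refine s.mono' _ _ ?_ h1
    rintro _ ⟨z, hz, rfl⟩
    exact Submodule.mul_mem_mul he hz

theorem one_mem (s : SemistarOperation R K) : (1 : K) ∈ s 1 :=
  s.le' 1 (Submodule.one_le.mp le_rfl)

theorem eq_one_of_mem (s : SemistarOperation R K) {E : Submodule R K} (h : E ≤ 1)
    (h1 : (1 : K) ∈ s E) : s E = s 1 := by
  refine le_antisymm (s.mono' _ _ h) ?_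
  rw [← s.idem' E]
  exact s.mono' _ _ (Submodule.one_le.mpr h1)

theorem mul_eq_one (s : SemistarOperation R K) {E F : Submodule R K}
    (hE : E ≤ 1) (hF : F ≤ 1) (hsE : s E = s 1) (hsF : s F = s 1) : s (E * F) = s 1 := by
  refine s.eq_one_of_mem ((mul_le_mul' hE hF).trans (one_mul 1).le) ?_
  have h : E ≤ s (E * F) := by
    refine le_trans ?_ (s.mul_le E F)
    rw [hsF]
    exact le_mul_of_one_le_right' (s.le' 1)
  have := s.mono' _ _ h
  rw [s.idem', hsE] at this
  exact this s.one_mem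

/-- The overring `R^⋆` of `R`. -/
def ring (s : SemistarOperation R K) : Subalgebra R K where
  carrier := s 1
  mul_mem' {a b} ha hb := by
    have h : s 1 * s 1 ≤ s 1 := by
      have := s.mul_le (s 1) 1
      rwa [mul_one, s.idem'] at this
    exact h (Submodule.mul_mem_mul ha hb)
  add_mem' ha hb := add_mem ha hb
  algebraMap_mem' r := s.le' 1 (Submodule.algebraMap_mem r)

/-- `E^{⋆_f}`, the union of all `F^⋆` with `F ⊆ E` finitely generated and nonzero (the union is
directed, hence it is the supremum). -/
def finiteType (s : SemistarOperation R K) (E : Submodule R K) : Submodule R K :=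
  ⨆ F : {F : Submodule R K // F.FG ∧ F ≠ ⊥ ∧ F ≤ E}, s F.1

theorem coeSubmodule_le_one (J : Ideal R) : IsLocalization.coeSubmodule K J ≤ 1 := by
  rw [← IsLocalization.coeSubmodule_top]
  exact Submodule.map_mono le_top

/-- The nonzero finitely generated ideals `J` of `R` with `J^⋆ = R^⋆`. -/
def IsDense (s : SemistarOperation R K) (J : Ideal R) : Prop :=
  J.FG ∧ J ≠ ⊥ ∧ s (IsLocalization.coeSubmodule K J) = s 1

theorem ne_bot_of_eq_one (s : SemistarOperation R K) {J : Ideal R}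
    (h : s (IsLocalization.coeSubmodule K J) = s 1) : J ≠ ⊥ := by
  rintro rfl
  rw [IsLocalization.coeSubmodule_bot, s.bot'] at h
  have := s.one_mem
  rw [← h] at this
  simp at this

theorem isDense_top (s : SemistarOperation R K) : s.IsDense ⊤ := by
  have h : s (IsLocalization.coeSubmodule K (⊤ : Ideal R)) = s 1 := by
    rw [IsLocalization.coeSubmodule_top]
  exact ⟨Ideal.fg_top R, s.ne_bot_of_eq_one h, h⟩

theorem IsDense.mul {s : SemistarOperation R K} {I J : Ideal R} (hI : s.IsDense I)
    (hJ : s.IsDense J) : s.IsDense (I * J) := by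
  have h : s (IsLocalization.coeSubmodule K (I * J)) = s 1 := by
    rw [IsLocalization.coeSubmodule_mul]
    exact s.mul_eq_one (coeSubmodule_le_one I) (coeSubmodule_le_one J) hI.2.2 hJ.2.2
  exact ⟨hI.1.mul hJ.1, s.ne_bot_of_eq_one h, h⟩

/-- `E^{⋆̃} = {x ∈ K | x J ⊆ E for some finitely generated J ⊆ R with J^⋆ = R^⋆}`. -/
def tildeFun (s : SemistarOperation R K) (E : Submodule R K) : Submodule R K where
  carrier := {x | ∃ J : Ideal R, s.IsDense J ∧ ∀ y ∈ J, x * algebraMap R K y ∈ E}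
  zero_mem' := ⟨⊤, s.isDense_top, by simp⟩
  add_mem' := by
    rintro a b ⟨I, hI, ha⟩ ⟨J, hJ, hb⟩
    refine ⟨I * J, hI.mul hJ, fun y hy => ?_⟩
    rw [add_mul]
    exact add_mem (ha y (Ideal.mul_le_left hy)) (hb y (Ideal.mul_le_right hy))
  smul_mem' := by
    rintro r a ⟨I, hI, ha⟩
    refine ⟨I, hI, fun y hy => ?_⟩
    rw [smul_mul_assoc]
    exact E.smul_mem r (ha y hy)

theorem exists_uniform_isDense (s : SemistarOperation R K) (E : Submodule R K) (x : K)
    (J : Ideal R) (hJ : J.FG) (h : ∀ y ∈ J, x * algebraMap R K y ∈ s.tildeFun E) :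
    ∃ I : Ideal R, s.IsDense I ∧
      ∀ y ∈ J, ∀ z ∈ I, x * algebraMap R K y * algebraMap R K z ∈ E := by
  induction J, hJ using Submodule.fg_induction with
  | singleton a =>
    obtain ⟨I, hI, hz⟩ := h a (Submodule.mem_span_singleton_self a)
    refine ⟨I, hI, fun y hy z hzI => ?_⟩
    obtain ⟨r, rfl⟩ := Submodule.mem_span_singleton.mp hy
    have := E.smul_mem r (hz z hzI)
    rw [Algebra.smul_def] at this
    convert this using 1
    simp only [smul_eq_mul, map_mul]
    ring
  | sup J₁ J₂ _ _ h₁ h₂ =>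
    obtain ⟨I₁, hI₁, hz₁⟩ := h₁ fun y hy => h y (Submodule.mem_sup_left hy)
    obtain ⟨I₂, hI₂, hz₂⟩ := h₂ fun y hy => h y (Submodule.mem_sup_right hy)
    refine ⟨I₁ * I₂, hI₁.mul hI₂, fun y hy z hz => ?_⟩
    obtain ⟨a, ha, b, hb, rfl⟩ := Submodule.mem_sup.mp hy
    rw [map_add, mul_add, add_mul]
    exact add_mem (hz₁ a ha z (Ideal.mul_le_left hz)) (hz₂ b hb z (Ideal.mul_le_right hz))

/-- The semistar operation `⋆̃` associated to `⋆`. -/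
def tilde [FaithfulSMul R K] (s : SemistarOperation R K) : SemistarOperation R K where
  toFun := s.tildeFun
  bot' := by
    rw [eq_bot_iff]
    rintro x ⟨J, hJ, hx⟩
    obtain ⟨y, hy, hy0⟩ := Submodule.exists_mem_ne_zero_of_ne_bot hJ.2.1
    have h := hx y hy
    simpa [hy0] using h
  smul' := by
    intro x hx E
    ext y
    rw [mem_smul_iff hx]
    constructor
    · rintro ⟨J, hJ, h⟩
      refine ⟨J, hJ, fun z hz => ?_⟩
      rw [mul_assoc]
      exact (mem_smul_iff hx _ _).mp (h z hz)
    · rintro ⟨J, hJ, h⟩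
      refine ⟨J, hJ, fun z hz => ?_⟩
      rw [mem_smul_iff hx, ← mul_assoc]
      exact h z hz
  mono' := by
    rintro E F hEF x ⟨J, hJ, h⟩
    exact ⟨J, hJ, fun y hy => hEF (h y hy)⟩
  le' := by
    intro E x hx
    refine ⟨⊤, s.isDense_top, fun y _ => ?_⟩
    rw [mul_comm, ← Algebra.smul_def]
    exact E.smul_mem y hx
  idem' := by
    intro E
    refine le_antisymm ?_ ?_
    · rintro x ⟨J, hJ, h⟩
      obtain ⟨I, hI, hI'⟩ := s.exists_uniform_isDense E x J hJ.1 h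
      refine ⟨J * I, hJ.mul hI, fun y hy => ?_⟩
      refine Submodule.mul_induction_on hy (fun a ha b hb => ?_) (fun a b ha hb => ?_)
      · rw [map_mul, ← mul_assoc]
        exact hI' a ha b hb
      · rw [map_add, mul_add]
        exact add_mem ha hb
    · intro x hx
      refine ⟨⊤, s.isDense_top, fun y _ => ?_⟩
      rw [mul_comm, ← Algebra.smul_def]
      exact (s.tildeFun E).smul_mem y hx

/-- For `F` finitely generated, `F^{⋆_a}` is the (directed) union of the modules
`((F G)^⋆ : G^⋆)`, with `G` running over the nonzero finitely generated submodules of `K`. -/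
def eabFG (s : SemistarOperation R K) (F : Submodule R K) : Submodule R K :=
  ⨆ G : {G : Submodule R K // G.FG ∧ G ≠ ⊥}, s (F * G.1) / s G.1

/-- `E^{⋆_a}`, for the e.a.b. semistar operation `⋆_a` associated to `⋆`: the (directed) union of
the `F^{⋆_a}` with `F ⊆ E` finitely generated and nonzero. -/
def eab (s : SemistarOperation R K) (E : Submodule R K) : Submodule R K :=
  ⨆ F : {F : Submodule R K // F.FG ∧ F ≠ ⊥ ∧ F ≤ E}, s.eabFG F.1

end SemistarOperation

/-- A Prüfer domain: a domain whose nonzero finitely generated ideals are all invertible. -/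
def IsPruferDomain (D : Type*) [CommRing D] : Prop :=
  IsDomain D ∧ ∀ I : Ideal D, I.FG → I ≠ ⊥ →
    IsUnit (I : FractionalIdeal D⁰ (FractionRing D))

/-! ### Graded domains -/

theorem uniqueSums_of_torsionFree (Γ : Type*) [AddCancelCommMonoid Γ] [IsAddTorsionFree Γ] :
    UniqueSums Γ where
  uniqueAdd_of_nonempty {A B} hA hB := by
    classical
    let M := AddSubmonoid.closure ((A ∪ B : Finset Γ) : Set Γ)
    have hAM : ∀ a ∈ A, a ∈ M := fun a ha =>
      AddSubmonoid.subset_closure (by simp [ha])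
    have hBM : ∀ b ∈ B, b ∈ M := fun b hb =>
      AddSubmonoid.subset_closure (by simp [hb])
    have : AddMonoid.FG M := (AddMonoid.fg_iff_addSubmonoid_fg M).mpr ⟨A ∪ B, rfl⟩
    have : IsAddTorsionFree M := Subtype.val_injective.isAddTorsionFree M.subtype
    let _ : AddCancelCommMonoid M :=
      { (inferInstance : AddCommMonoid M) with
        add_left_cancel := fun a b c h =>
          Subtype.ext (add_left_cancel (congrArg Subtype.val h)) }
    have : UniqueSums M := (AffineAddMonoid.to_twoUniqueSums (M := M)).toUniqueSums
    obtain ⟨a, ha, b, hb, hu⟩ := UniqueSums.uniqueAdd_of_nonempty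
      (A := A.subtype (· ∈ M)) (B := B.subtype (· ∈ M))
      (by obtain ⟨a, ha⟩ := hA; exact ⟨⟨a, hAM a ha⟩, by simpa using ha⟩)
      (by obtain ⟨b, hb⟩ := hB; exact ⟨⟨b, hBM b hb⟩, by simpa using hb⟩)
    refine ⟨a.1, by simpa using ha, b.1, by simpa using hb, fun x y hx hy hxy => ?_⟩
    have := hu (a := ⟨x, hAM x hx⟩) (b := ⟨y, hBM y hy⟩) (by simpa using hx) (by simpa using hy)
      (Subtype.ext hxy)
    exact ⟨congrArg Subtype.val this.1, congrArg Subtype.val this.2⟩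

namespace GradedDomain

variable {Γ R : Type*} [AddCancelCommMonoid Γ] [DecidableEq Γ] [CommRing R]
variable (𝒜 : Γ → AddSubgroup R) [GradedRing 𝒜]

/-- The ideal `C(f)` of `R` generated by the homogeneous components of `f`. -/
def content (f : R) : Ideal R :=
  Ideal.span (Set.range fun α => (DirectSum.decompose 𝒜 f α : R))

theorem content_fg (f : R) : (content 𝒜 f).FG := by
  classical
  refine ⟨insert 0 ((DirectSum.decompose 𝒜 f).support.image
    fun α => (DirectSum.decompose 𝒜 f α : R)), ?_⟩
  refine le_antisymm (Submodule.span_le.mpr ?_) (Submodule.span_le.mpr ?_)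
  · intro x hx
    simp only [Finset.coe_insert, Finset.coe_image, Set.mem_insert_iff, Set.mem_image] at hx
    rcases hx with rfl | ⟨α, -, rfl⟩
    · exact zero_mem _
    · exact Ideal.subset_span ⟨α, rfl⟩
  · rintro _ ⟨α, rfl⟩
    refine Submodule.subset_span ?_
    by_cases h : DirectSum.decompose 𝒜 f α = 0
    · simp [h]
    · simp only [Finset.coe_insert, Finset.coe_image, Set.mem_insert_iff, Set.mem_image]
      exact Or.inr ⟨α, by simpa using h, rfl⟩

theorem content_one : content 𝒜 (1 : R) = ⊤ := by
  rw [Ideal.eq_top_iff_one]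
  refine Ideal.subset_span ⟨0, ?_⟩
  exact DirectSum.decompose_of_mem_same 𝒜 SetLike.GradedOne.one_mem

theorem content_le_or_le_of_mul [IsAddTorsionFree Γ] (P : Ideal R) [hP : P.IsPrime] (f g : R)
    (h : content 𝒜 (f * g) ≤ P) : content 𝒜 f ≤ P ∨ content 𝒜 g ≤ P := by
  classical
  have := uniqueSums_of_torsionFree Γ
  by_contra hcon
  rw [not_or] at hcon
  have key : ∀ f : R, ¬ content 𝒜 f ≤ P → ((DirectSum.decompose 𝒜 f).support.filter
      fun α => (DirectSum.decompose 𝒜 f α : R) ∉ P).Nonempty := by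
    intro f hf
    rw [content, Ideal.span_le, Set.not_subset] at hf
    obtain ⟨_, ⟨α, rfl⟩, hα⟩ := hf
    refine ⟨α, Finset.mem_filter.mpr ⟨?_, hα⟩⟩
    rw [DFinsupp.mem_support_toFun]
    intro h0
    refine hα ?_
    simp [h0]
  obtain ⟨i, hi, j, hj, hu⟩ :=
    UniqueSums.uniqueAdd_of_nonempty (key f hcon.1) (key g hcon.2)
  have hmem : (DirectSum.decompose 𝒜 (f * g) (i + j) : R) ∈ P :=
    h (Ideal.subset_span ⟨i + j, rfl⟩)
  rw [DirectSum.decompose_mul, DirectSum.coe_mul_apply,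
    ← Finset.add_sum_erase _ _ (a := (i, j)) (by
      simp only [Finset.mem_filter, Finset.mem_product]
      exact ⟨⟨(Finset.mem_filter.mp hi).1, (Finset.mem_filter.mp hj).1⟩, trivial⟩)] at hmem
  have hrest : ∑ x ∈ (Finset.filter (fun x : Γ × Γ => x.1 + x.2 = i + j)
      ((DirectSum.decompose 𝒜 f).support ×ˢ (DirectSum.decompose 𝒜 g).support)).erase (i, j),
      (DirectSum.decompose 𝒜 f x.1 : R) * (DirectSum.decompose 𝒜 g x.2 : R) ∈ P := by
    refine Ideal.sum_mem _ fun x hx => ?_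
    simp only [Finset.mem_erase, Finset.mem_filter, Finset.mem_product] at hx
    obtain ⟨hne, ⟨h1, h2⟩, h3⟩ := hx
    by_contra hc
    have ha : (DirectSum.decompose 𝒜 f x.1 : R) ∉ P := fun h' => hc (P.mul_mem_right _ h')
    have hb : (DirectSum.decompose 𝒜 g x.2 : R) ∉ P := fun h' => hc (P.mul_mem_left _ h')
    have := hu (Finset.mem_filter.mpr ⟨h1, ha⟩) (Finset.mem_filter.mpr ⟨h2, hb⟩) h3
    exact hne (Prod.ext this.1 this.2)
  have hprod := (Ideal.add_mem_iff_left P hrest).mp hmem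
  rcases hP.mem_or_mem hprod with h' | h'
  · exact (Finset.mem_filter.mp hi).2 h'
  · exact (Finset.mem_filter.mp hj).2 h'

theorem exists_content_pow_le [IsAddTorsionFree Γ] (f g : R) :
    ∃ n : ℕ, (content 𝒜 f * content 𝒜 g) ^ n ≤ content 𝒜 (f * g) := by
  refine Ideal.exists_pow_le_of_le_radical_of_fg ?_ ((content_fg 𝒜 f).mul (content_fg 𝒜 g))
  rw [Ideal.radical_eq_sInf]
  refine le_sInf fun P hP => ?_
  have := hP.2
  rcases content_le_or_le_of_mul 𝒜 P f g hP.1 with h | h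
  · exact Ideal.mul_le_left.trans h
  · exact Ideal.mul_le_right.trans h

/-- The multiplicative set `H` of nonzero homogeneous elements of `R`. -/
def homogeneousElements [IsDomain R] : Submonoid R where
  carrier := {a | SetLike.IsHomogeneousElem 𝒜 a ∧ a ≠ 0}
  one_mem' := ⟨SetLike.isHomogeneousElem_one 𝒜, one_ne_zero⟩
  mul_mem' ha hb := ⟨ha.1.mul hb.1, mul_ne_zero ha.2 hb.2⟩

variable {K : Type*} [Field K] [Algebra R K]

/-- The multiplicative set `N_⋆(H) = {f ∈ R | C(f)^⋆ = R^⋆}`. -/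
def nagataSet [IsAddTorsionFree Γ] (s : SemistarOperation R K) : Submonoid R where
  carrier := {f | s (IsLocalization.coeSubmodule K (content 𝒜 f)) = s 1}
  one_mem' := by
    simp only [Set.mem_ofPred_eq, content_one, IsLocalization.coeSubmodule_top]
  mul_mem' {f g} hf hg := by
    have hf' : s.IsDense (content 𝒜 f) := ⟨content_fg 𝒜 f, s.ne_bot_of_eq_one hf, hf⟩
    have hg' : s.IsDense (content 𝒜 g) := ⟨content_fg 𝒜 g, s.ne_bot_of_eq_one hg, hg⟩
    obtain ⟨n, hn⟩ := exists_content_pow_le 𝒜 f g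
    have hpow : ∀ n : ℕ, s.IsDense ((content 𝒜 f * content 𝒜 g) ^ n) := by
      intro n
      induction n with
      | zero => simpa using s.isDense_top
      | succ n ih => rw [pow_succ]; exact ih.mul (hf'.mul hg')
    refine s.eq_one_of_mem (SemistarOperation.coeSubmodule_le_one _) ?_
    refine s.mono' _ _ (Submodule.map_mono hn) ?_
    have := (hpow n).2.2
    rw [IsLocalization.coeSubmodule] at this
    rw [this]
    exact s.one_mem

variable [IsDomain R]

theorem homogeneousElements_le : homogeneousElements 𝒜 ≤ R⁰ :=
  fun _ ha => mem_nonZeroDivisors_of_ne_zero ha.2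

theorem nagataSet_le [IsAddTorsionFree Γ] (s : SemistarOperation R K) :
    nagataSet 𝒜 s ≤ R⁰ := by
  intro f hf
  refine mem_nonZeroDivisors_of_ne_zero ?_
  rintro rfl
  refine s.ne_bot_of_eq_one hf ?_
  simp [content]

variable [IsFractionRing R K]

variable (K) in
/-- The homogeneous quotient field `R_H`, inside `K`. -/
noncomputable def homogeneousQuotientField : Subalgebra R K :=
  Localization.subalgebra.ofField K (homogeneousElements 𝒜) (homogeneousElements_le 𝒜)

/-- The graded Nagata ring `R_{N_⋆(H)}`, inside `K`. -/
noncomputable def nagataRing [IsAddTorsionFree Γ] (s : SemistarOperation R K) : Subalgebra R K :=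
  Localization.subalgebra.ofField K (nagataSet 𝒜 s) (nagataSet_le 𝒜 s)

/-- The elements of the graded Kronecker function ring `Kr(R, ⋆)`: the fractions `f / g` with
`f, g ∈ R`, `g ≠ 0`, such that `C(f) C(h) ⊆ (C(g) C(h))^⋆` for some nonzero `h ∈ R`. -/
def kroneckerSet (s : SemistarOperation R K) : Set K :=
  {x | ∃ f g : R, g ≠ 0 ∧ x = algebraMap R K f / algebraMap R K g ∧ ∃ h : R, h ≠ 0 ∧
    IsLocalization.coeSubmodule K (content 𝒜 f * content 𝒜 h) ≤
      s (IsLocalization.coeSubmodule K (content 𝒜 g * content 𝒜 h))}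

/-- `R` is a graded Prüfer `⋆`-multiplication domain: `(I I⁻¹)^{⋆_f} = R^⋆` for every nonzero
finitely generated homogeneous ideal `I`, where `I⁻¹ = (R : I)`. -/
def IsGradedPStarMD (s : SemistarOperation R K) : Prop :=
  ∀ I : Ideal R, I.IsHomogeneous 𝒜 → I.FG → I ≠ ⊥ →
    s.finiteType (IsLocalization.coeSubmodule K I * (1 / IsLocalization.coeSubmodule K I)) = s 1

end GradedDomain

open scoped Pointwise nonZeroDivisors

set_option linter.unusedSectionVars false

namespace GradedDomain

/-! ### Contents and homogeneous ideals. -/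

section Content

variable {Γ R : Type*} [AddCancelCommMonoid Γ] [DecidableEq Γ] [CommRing R]
variable (𝒜 : Γ → AddSubgroup R) [GradedRing 𝒜]

/-! Write N for N_⋆(H) and T for R_N. The homogeneous unit of nonzero degree lets single elements
stand for ideals: multiplying g by a suitable power v of it moves the components of g away from
those of f, so C(f + gv) = C(f) + C(g), and every finitely generated homogeneous ideal is the
content of one element. The conditions are then all compared with one property: every nonzero
finitely generated homogeneous I is invertible up to N, meaning IB ⊆ aR and ar ∈ IB for some a ≠ 0,
some B and some r ∈ N (`isGradedPStarMD_iff`).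

Two weak forms of Dedekind–Mertens relate elements to contents. If W is homogeneous and fx ∈ W, then
C(f)^n C(x) ⊆ W for some n. Also C(f)C(x) ≺ C(fx), where I ≺ J means IH ⊆ (JH)^⋆ for some nonzero
finitely generated homogeneous H. The relation ≺ is a preorder compatible with sums and products,
and such H cancel. Hence f/g ∈ Kr means C(f) ≺ C(g) (with ⋆̃ for ⋆), whatever fraction is chosen,
and Kr is a ring.

Invertibility up to N gives C(f)T = fT for all f. From this follow the extension of ideals from
homogeneous ones, the Bézout property and T = Kr. Conversely, if T is Prüfer, an inverse of IT
descends to R after clearing finitely many denominators. If Kr is flat, then C(f)Kr = f Kr forces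
the ideal (f : C(f)) to extend to Kr, and so to meet N.

For condition 9, T ∩ R_H ⊆ R^⋆̃, and both R_H and (under condition 1) the Bézout domain T are
integrally closed; so R^⋆̃ contains the elements integral over R, and a determinant trick gives
I^⋆̃_a ⊆ I^⋆̃. That R_H is integrally closed is seen by specializing the grading to ℤ and dividing
Laurent polynomials. Conversely, 9 yields ab ∈ (a², b²)^⋆̃ for homogeneous a and b, which makes (a,
b) invertible up to N by Prüfer's argument; more generators follow from (A+B)(A+C)(B+C) =
(A+B+C)(AB+BC+CA). -/

theorem decompose_mem_content (f : R) (α : Γ) :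
    (DirectSum.decompose 𝒜 f α : R) ∈ content 𝒜 f :=
  Ideal.subset_span ⟨α, rfl⟩

theorem content_isHomogeneous (f : R) : (content 𝒜 f).IsHomogeneous 𝒜 := by
  refine Ideal.homogeneous_span 𝒜 _ ?_
  rintro _ ⟨α, rfl⟩
  exact ⟨α, SetLike.coe_mem _⟩

theorem mem_content_self (f : R) : f ∈ content 𝒜 f := by
  classical
  have := Ideal.sum_mem (content 𝒜 f) (t := (DirectSum.decompose 𝒜 f).support)
    fun α _ => decompose_mem_content 𝒜 f α
  rwa [DirectSum.sum_support_decompose] at this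

variable {𝒜}

theorem content_le_iff {I : Ideal R} (hI : I.IsHomogeneous 𝒜) {f : R} :
    content 𝒜 f ≤ I ↔ f ∈ I := by
  refine ⟨fun h => h (mem_content_self 𝒜 f), fun h => Ideal.span_le.mpr ?_⟩
  rintro _ ⟨α, rfl⟩
  exact hI α h

variable (𝒜)

theorem content_ne_bot {f : R} (hf : f ≠ 0) : content 𝒜 f ≠ ⊥ := by
  intro h
  have := mem_content_self 𝒜 f
  rw [h] at this
  exact hf (by simpa using this)

@[simp]
theorem content_zero : content 𝒜 (0 : R) = ⊥ := by
  rw [eq_bot_iff, content_le_iff (Ideal.IsHomogeneous.bot 𝒜)]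
  exact zero_mem _

theorem content_mul_le (f g : R) : content 𝒜 (f * g) ≤ content 𝒜 f * content 𝒜 g :=
  (content_le_iff ((content_isHomogeneous 𝒜 f).mul (content_isHomogeneous 𝒜 g))).mpr
    (Ideal.mul_mem_mul (mem_content_self 𝒜 f) (mem_content_self 𝒜 g))

theorem content_add_le (f g : R) : content 𝒜 (f + g) ≤ content 𝒜 f ⊔ content 𝒜 g :=
  (content_le_iff ((content_isHomogeneous 𝒜 f).sup (content_isHomogeneous 𝒜 g))).mpr
    (add_mem (Ideal.mem_sup_left (mem_content_self 𝒜 f))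
      (Ideal.mem_sup_right (mem_content_self 𝒜 g)))

theorem content_le_of_mem_content {f g : R} (h : g ∈ content 𝒜 f) :
    content 𝒜 g ≤ content 𝒜 f :=
  (content_le_iff (content_isHomogeneous 𝒜 f)).mpr h

theorem content_neg (f : R) : content 𝒜 (-f) = content 𝒜 f :=
  le_antisymm (content_le_of_mem_content 𝒜 (neg_mem (mem_content_self 𝒜 f)))
    (content_le_of_mem_content 𝒜 (neg_mem_iff.mp (mem_content_self 𝒜 (-f))))

theorem content_mul_of_isUnit (f : R) {v : R} (hv : IsUnit v) :
    content 𝒜 (f * v) = content 𝒜 f := by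
  refine le_antisymm (content_le_of_mem_content 𝒜
    (Ideal.mul_mem_right _ _ (mem_content_self 𝒜 f))) (content_le_of_mem_content 𝒜 ?_)
  exact (Ideal.mul_unit_mem_iff_mem _ hv).mp (mem_content_self 𝒜 (f * v))

variable {𝒜} in
theorem content_of_isHomogeneousElem {a : R} (ha : SetLike.IsHomogeneousElem 𝒜 a) :
    content 𝒜 a = Ideal.span {a} := by
  refine le_antisymm ?_ ((Ideal.span_singleton_le_iff_mem _).mpr (mem_content_self 𝒜 a))
  exact (content_le_iff (Ideal.homogeneous_span 𝒜 _ (by rintro _ rfl; exact ha))).mpr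
    (Ideal.mem_span_singleton_self a)

/-- When the supports are disjoint no components merge, so each component of f and of g survives in
f + g. -/
theorem content_add_eq_sup {f g : R}
    (h : ∀ α, DirectSum.decompose 𝒜 f α = 0 ∨ DirectSum.decompose 𝒜 g α = 0) :
    content 𝒜 (f + g) = content 𝒜 f ⊔ content 𝒜 g := by
  refine le_antisymm (content_add_le 𝒜 f g) (sup_le ?_ ?_)
  · refine Ideal.span_le.mpr ?_
    rintro _ ⟨α, rfl⟩
    rcases h α with h | h
    · simp [h]
    · have := decompose_mem_content 𝒜 (f + g) α
      simpa [DirectSum.decompose_add, h] using this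
  · refine Ideal.span_le.mpr ?_
    rintro _ ⟨α, rfl⟩
    rcases h α with h | h
    · have := decompose_mem_content 𝒜 (f + g) α
      simpa [DirectSum.decompose_add, h] using this
    · simp [h]

theorem exists_decompose_ne_zero_of_mul_mem {g v : R} {β α : Γ} (hv : v ∈ 𝒜 β)
    (h : DirectSum.decompose 𝒜 (g * v) α ≠ 0) :
    ∃ j, DirectSum.decompose 𝒜 g j ≠ 0 ∧ j + β = α := by
  classical
  by_contra hcon
  push Not at hcon
  refine h (Subtype.ext ?_)
  conv_lhs => rw [← DirectSum.sum_support_decompose 𝒜 g, Finset.sum_mul]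
  rw [DirectSum.decompose_sum, DFinsupp.finsetSum_apply, AddSubmonoidClass.coe_finsetSum]
  refine Finset.sum_eq_zero fun j hj => ?_
  exact DirectSum.decompose_of_mem_ne 𝒜 (SetLike.mul_mem_graded (SetLike.coe_mem _) hv)
    (hcon j (by simpa using hj))

variable [IsAddTorsionFree Γ]

/-- Multiplication by a unit leaves the content unchanged, so g may be shifted by a power of u until
its support misses that of f. The version with the minus sign, for the same v, serves the identity
(a + bv)(a − bv) = a² − b²v². -/
theorem exists_isUnit_content_add_mul (hunit : ∃ α : Γ, α ≠ 0 ∧ ∃ u ∈ 𝒜 α, IsUnit u) (f g : R) :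
    ∃ v : R, IsUnit v ∧ content 𝒜 (f + g * v) = content 𝒜 f ⊔ content 𝒜 g ∧
      content 𝒜 (f - g * v) = content 𝒜 f ⊔ content 𝒜 g := by
  classical
  obtain ⟨α, hα, u, hu, huu⟩ := hunit
  have hk : ∃ k : ℕ, ∀ i ∈ (DirectSum.decompose 𝒜 f).support,
      ∀ j ∈ (DirectSum.decompose 𝒜 g).support, j + k • α ≠ i := by
    by_contra hcon
    push Not at hcon
    choose i hi j hj hij using hcon
    -- If every shift produced a collision, two exponents k ≠ k' would do so at the same pair of
    -- degrees; then kα = k'α, against torsion-freeness.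
    obtain ⟨k, k', hne, heq⟩ := Finite.exists_ne_map_eq_of_infinite
      (fun k : ℕ => ((⟨i k, hi k⟩, ⟨j k, hj k⟩) :
        (DirectSum.decompose 𝒜 f).support × (DirectSum.decompose 𝒜 g).support))
    simp only [Prod.mk.injEq, Subtype.mk.injEq] at heq
    have h3 : k • α = k' • α := by
      have h1 := hij k
      rw [heq.1, heq.2, ← hij k'] at h1
      exact add_left_cancel h1
    wlog hlt : k < k' generalizing k k'
    · exact this k' k hne.symm ⟨heq.1.symm, heq.2.symm⟩ h3.symm
        (lt_of_le_of_ne (not_lt.mp hlt) hne.symm)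
    obtain ⟨m, rfl⟩ := Nat.exists_eq_add_of_lt hlt
    rw [show k + m + 1 = k + (m + 1) by ring, add_nsmul] at h3
    have h4 : (m + 1) • α = 0 := by simpa using h3.symm
    exact hα (nsmul_right_injective (M := Γ) (Nat.succ_ne_zero m) (by simpa using h4))
  obtain ⟨k, hk⟩ := hk
  have hmem : u ^ k ∈ 𝒜 (k • α) := SetLike.pow_mem_graded k hu
  have hv : IsUnit (u ^ k) := huu.pow k
  have hdisj : ∀ γ, DirectSum.decompose 𝒜 f γ = 0 ∨
      DirectSum.decompose 𝒜 (g * u ^ k) γ = 0 := by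
    intro γ
    by_contra hcon
    rw [not_or] at hcon
    obtain ⟨j, hj, hjγ⟩ := exists_decompose_ne_zero_of_mul_mem 𝒜 hmem hcon.2
    exact hk γ (by simpa using hcon.1) j (by simpa using hj) hjγ
  refine ⟨u ^ k, hv, ?_, ?_⟩
  · rw [content_add_eq_sup 𝒜 hdisj, content_mul_of_isUnit 𝒜 g hv]
  · rw [sub_eq_add_neg, content_add_eq_sup 𝒜, content_neg, content_mul_of_isUnit 𝒜 g hv]
    intro γ
    refine (hdisj γ).imp_right fun h => ?_
    rw [DirectSum.decompose_neg]
    exact neg_eq_zero.mpr h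

theorem exists_mem_le_content (hunit : ∃ α : Γ, α ≠ 0 ∧ ∃ u ∈ 𝒜 α, IsUnit u) {J : Ideal R}
    (hJ : J.FG) : ∃ r ∈ J, J ≤ content 𝒜 r := by
  induction J, hJ using Submodule.fg_induction with
  | singleton a =>
    exact ⟨a, Submodule.mem_span_singleton_self a,
      (Ideal.span_singleton_le_iff_mem _).mpr (mem_content_self 𝒜 a)⟩
  | sup J₁ J₂ _ _ h₁ h₂ =>
    obtain ⟨r₁, hr₁, h₁⟩ := h₁
    obtain ⟨r₂, hr₂, h₂⟩ := h₂
    obtain ⟨v, -, hv, -⟩ := exists_isUnit_content_add_mul 𝒜 hunit r₁ r₂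
    exact ⟨r₁ + r₂ * v, add_mem (Ideal.mem_sup_left hr₁)
      (Ideal.mem_sup_right (Ideal.mul_mem_right _ _ hr₂)), by
        rw [hv]; exact sup_le_sup h₁ h₂⟩

-- This allows the ideals H in the definition of domination to be replaced by contents C(h), as in
-- the definition of Kr.
variable {𝒜} in
theorem exists_content_eq (hunit : ∃ α : Γ, α ≠ 0 ∧ ∃ u ∈ 𝒜 α, IsUnit u) {I : Ideal R}
    (hI : I.IsHomogeneous 𝒜) (hfg : I.FG) : ∃ r, content 𝒜 r = I := by
  obtain ⟨r, hr, h⟩ := exists_mem_le_content 𝒜 hunit hfg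
  exact ⟨r, le_antisymm ((content_le_iff hI).mpr hr) h⟩

end Content

end GradedDomain

namespace GradedDomain

/-! ### The Dedekind–Mertens lemma inside a homogeneous ideal. -/

section DedekindMertens

variable {Γ R : Type*} [AddCancelCommMonoid Γ] [DecidableEq Γ] [CommRing R]
variable {𝒜 : Γ → AddSubgroup R} [GradedRing 𝒜]

theorem colon_isHomogeneous {W L : Ideal R} (hW : W.IsHomogeneous 𝒜) (hL : L.IsHomogeneous 𝒜) :
    (W.colon (L : Set R)).IsHomogeneous 𝒜 := by
  classical
  intro i b hb
  rw [Submodule.mem_colon] at hb ⊢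
  intro y hy
  rw [← DirectSum.sum_support_decompose 𝒜 y, Finset.smul_sum]
  refine Ideal.sum_mem _ fun j _ => ?_
  have h := hW (i + j) (hb _ (hL j hy))
  rwa [smul_eq_mul, DirectSum.coe_decompose_mul_add_of_right_mem 𝒜 (SetLike.coe_mem _)] at h

variable (𝒜) in
/-- The number of nonzero homogeneous components. -/
noncomputable def numComponents (f : R) : ℕ :=
  {α | DirectSum.decompose 𝒜 f α ≠ 0}.ncard

theorem finite_components (f : R) : {α | DirectSum.decompose 𝒜 f α ≠ 0}.Finite := by
  classical
  refine (DirectSum.decompose 𝒜 f).support.finite_toSet.subset fun α hα => ?_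
  simpa using hα

theorem numComponents_sub_lt {f : R} {i : Γ} (hi : DirectSum.decompose 𝒜 f i ≠ 0) :
    numComponents 𝒜 (f - DirectSum.decompose 𝒜 f i) < numComponents 𝒜 f := by
  refine Set.ncard_lt_ncard ?_ (finite_components f)
  have hz : DirectSum.decompose 𝒜 (f - DirectSum.decompose 𝒜 f i) i = 0 := by
    rw [DirectSum.decompose_sub, DirectSum.sub_apply, DirectSum.decompose_coe, DirectSum.of_eq_same,
      sub_self]
  refine ⟨fun α hα => ?_, fun h => h hi hz⟩
  intro h0
  rcases eq_or_ne i α with rfl | hne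
  · exact hα hz
  · refine hα ?_
    rw [DirectSum.decompose_sub, DirectSum.sub_apply, h0, DirectSum.decompose_coe,
      DirectSum.of_eq_of_ne _ _ _ hne.symm, sub_zero]

theorem content_le_sub_decompose_sup (f : R) (i : Γ) :
    content 𝒜 f ≤ content 𝒜 (f - DirectSum.decompose 𝒜 f i) ⊔
      Ideal.span {(DirectSum.decompose 𝒜 f i : R)} := by
  have := content_add_le 𝒜 (f - DirectSum.decompose 𝒜 f i) (DirectSum.decompose 𝒜 f i : R)
  rwa [sub_add_cancel, content_of_isHomogeneousElem ⟨i, SetLike.coe_mem _⟩] at this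

variable [IsAddTorsionFree Γ]

-- Unique sums give a degree i + j reached by only one pair of degrees from the two supports. It
-- plays the role of the leading term.
variable (𝒜) in
theorem exists_decompose_mul_eq {f x : R} (hf : f ≠ 0) (hx : x ≠ 0) :
    ∃ i j, DirectSum.decompose 𝒜 f i ≠ 0 ∧ DirectSum.decompose 𝒜 x j ≠ 0 ∧
      (DirectSum.decompose 𝒜 (f * x) (i + j) : R) =
        DirectSum.decompose 𝒜 f i * DirectSum.decompose 𝒜 x j := by
  classical
  have := uniqueSums_of_torsionFree Γ
  have key : ∀ f : R, f ≠ 0 → (DirectSum.decompose 𝒜 f).support.Nonempty := by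
    intro f hf
    rw [Finset.nonempty_iff_ne_empty, Ne, DFinsupp.support_eq_empty]
    exact fun h => hf ((DirectSum.decompose 𝒜).injective (by rw [h, DirectSum.decompose_zero]))
  obtain ⟨i, hi, j, hj, hu⟩ := UniqueSums.uniqueAdd_of_nonempty (key f hf) (key x hx)
  refine ⟨i, j, by simpa using hi, by simpa using hj, ?_⟩
  rw [DirectSum.decompose_mul, DirectSum.coe_mul_apply]
  refine Finset.sum_eq_single (i, j) (fun p hp hne => ?_) (fun h => ?_)
  · simp only [Finset.mem_filter, Finset.mem_product] at hp
    have := hu hp.1.1 hp.1.2 hp.2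
    exact absurd (Prod.ext this.1 this.2) hne
  · refine absurd ?_ h
    exact Finset.mem_filter.mpr ⟨Finset.mem_product.mpr ⟨hi, hj⟩, rfl⟩

/-- A weak form of the Dedekind–Mertens lemma. -/
theorem exists_content_pow_mul_content_le {W : Ideal R} (hW : W.IsHomogeneous 𝒜) {f x : R}
    (h : f * x ∈ W) : ∃ n : ℕ, content 𝒜 f ^ n * content 𝒜 x ≤ W := by
  induction hn : numComponents 𝒜 f + numComponents 𝒜 x using Nat.strong_induction_on
    generalizing f x W with
  | _ n ih =>
  subst hn
  rcases eq_or_ne x 0 with rfl | hx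
  · exact ⟨0, by simp⟩
  rcases eq_or_ne f 0 with rfl | hf
  · exact ⟨1, by simp⟩
  obtain ⟨i, j, hi, hj, hij⟩ := exists_decompose_mul_eq 𝒜 hf hx
  set a : R := (DirectSum.decompose 𝒜 f i : R)
  set b : R := (DirectSum.decompose 𝒜 x j : R)
  have hab : a * b ∈ W := hij ▸ hW (i + j) h
  have hspan : (Ideal.span {a}).IsHomogeneous 𝒜 :=
    Ideal.homogeneous_span 𝒜 _ (by rintro _ rfl; exact ⟨i, SetLike.coe_mem _⟩)
  -- Since a·f(x − b) = a·fx − f·ab and ab ∈ W, the element f(x − b) lies in W : a, and x − b has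
  -- one component fewer.
  obtain ⟨n₁, hn₁⟩ := ih _ (Nat.add_lt_add_left (numComponents_sub_lt hj) _)
    (W := W.colon (Ideal.span {a} : Set R)) (f := f) (x := x - b) (colon_isHomogeneous hW hspan) (by
      rw [Submodule.mem_colon]
      intro y hy
      obtain ⟨c, rfl⟩ := Ideal.mem_span_singleton'.mp hy
      have : (f * (x - b)) • (c * a) = (c * a) * (f * x) - (c * f) * (a * b) := by
        rw [smul_eq_mul]; ring
      rw [this]
      exact sub_mem (W.mul_mem_left _ h) (W.mul_mem_left _ hab)) rfl
  have h₁ : content 𝒜 f ^ n₁ * content 𝒜 x * Ideal.span {a} ≤ W := by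
    refine (Ideal.mul_mono_left (Ideal.mul_mono_right (content_le_sub_decompose_sup x j))).trans ?_
    rw [Ideal.mul_sup, Ideal.sup_mul]
    refine sup_le ?_ ?_
    · rw [Ideal.mul_le]
      exact fun r hr y hy => Submodule.mem_colon.mp (hn₁ hr) y hy
    · rw [mul_assoc, Ideal.span_singleton_mul_span_singleton, mul_comm b a]
      exact Ideal.mul_le_right.trans ((Ideal.span_singleton_le_iff_mem _).mpr hab)
  have hpow : (content 𝒜 f ^ n₁).IsHomogeneous 𝒜 := by
    clear hn₁ h₁
    induction n₁ with
    | zero => simpa using Ideal.IsHomogeneous.top 𝒜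
    | succ n ih => rw [pow_succ]; exact ih.mul (content_isHomogeneous 𝒜 f)
  -- Now remove a from f instead: the error term xya, with y ∈ C(f)^n₁, is absorbed by `h₁`, so (f −
  -- a)x lies in W : C(f)^n₁.
  obtain ⟨n₂, hn₂⟩ := ih _ (Nat.add_lt_add_right (numComponents_sub_lt hi) _)
    (W := W.colon (content 𝒜 f ^ n₁ : Ideal R)) (f := f - a) (x := x)
    (colon_isHomogeneous hW hpow) (by
      rw [Submodule.mem_colon]
      intro y hy
      have : ((f - a) * x) • y = y * (f * x) - y * x * a := by rw [smul_eq_mul]; ring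
      rw [this]
      exact sub_mem (W.mul_mem_left _ h) (h₁ (Ideal.mul_mem_mul
        (Ideal.mul_mem_mul hy (mem_content_self 𝒜 x)) (Ideal.mem_span_singleton_self a)))) rfl
  refine ⟨n₁ + (n₂ + 1), ?_⟩
  -- With C(f) ⊆ C(f − a) + (a), every term of the expansion lies in C(f − a)^n₂ or contains a
  -- factor a; `hn₂` handles the first kind and `h₁` the second.
  have h₂ : content 𝒜 f ^ (n₂ + 1) ≤ content 𝒜 (f - a) ^ n₂ ⊔ Ideal.span {a} := by
    refine (Ideal.pow_right_mono (content_le_sub_decompose_sup f i) _).trans ?_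
    simpa using Ideal.sup_pow_add_le_pow_sup_pow (I := content 𝒜 (f - a)) (J := Ideal.span {a})
      (n := n₂) (m := 1)
  rw [pow_add, mul_assoc, mul_comm]
  refine (Ideal.mul_mono_left (Ideal.mul_mono_left h₂)).trans ?_
  rw [Ideal.sup_mul, Ideal.sup_mul]
  refine sup_le ?_ (le_of_eq_of_le (by ring) h₁)
  rw [Ideal.mul_le]
  exact fun r hr y hy => Submodule.mem_colon.mp (hn₂ hr) y hy

end DedekindMertens

/-! ### Domination of ideals, and Dedekind–Mertens up to a common factor. -/

section Dominated

variable {Γ R K : Type*} [AddCancelCommMonoid Γ] [DecidableEq Γ] [CommRing R]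
variable {𝒜 : Γ → AddSubgroup R} [GradedRing 𝒜] [Field K] [Algebra R K]

variable (𝒜) in
/-- `I` is dominated by `J` if `I H ⊆ (J H)^⋆` for some nonzero finitely generated homogeneous
ideal `H`. -/
def Dominated (s : SemistarOperation R K) (I J : Ideal R) : Prop :=
  ∃ H : Ideal R, H.IsHomogeneous 𝒜 ∧ H.FG ∧ H ≠ ⊥ ∧
    IsLocalization.coeSubmodule K (I * H) ≤ s (IsLocalization.coeSubmodule K (J * H))

theorem _root_.SemistarOperation.coeSubmodule_mul_le (s : SemistarOperation R K) {A B : Ideal R}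
    (h : IsLocalization.coeSubmodule K A ≤ s (IsLocalization.coeSubmodule K B)) (L : Ideal R) :
    IsLocalization.coeSubmodule K (L * A) ≤ s (IsLocalization.coeSubmodule K (L * B)) := by
  rw [IsLocalization.coeSubmodule_mul, IsLocalization.coeSubmodule_mul]
  exact (mul_le_mul_right h _).trans (s.mul_le _ _)

theorem _root_.SemistarOperation.le_of_le_of_le (s : SemistarOperation R K) {A B C : Submodule R K}
    (h₁ : A ≤ s B) (h₂ : B ≤ s C) : A ≤ s C :=
  h₁.trans ((s.mono' _ _ h₂).trans (s.idem' C).le)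

namespace Dominated

variable {s : SemistarOperation R K} {I J L M : Ideal R}

theorem of_le [Nontrivial R] (h : I ≤ J) : Dominated 𝒜 s I J :=
  ⟨⊤, Ideal.IsHomogeneous.top 𝒜, Ideal.fg_top R, top_ne_bot,
    (Submodule.map_mono (Ideal.mul_mono_left h)).trans (s.le' _)⟩

theorem mul_right (h : Dominated 𝒜 s I J) (L : Ideal R) : Dominated 𝒜 s (I * L) (J * L) := by
  obtain ⟨H, h1, h2, h3, h4⟩ := h
  refine ⟨H, h1, h2, h3, ?_⟩
  have := s.coeSubmodule_mul_le h4 L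
  rwa [show I * L * H = L * (I * H) by ring, show J * L * H = L * (J * H) by ring]

variable [IsDomain R]

theorem trans (h : Dominated 𝒜 s I J) (h' : Dominated 𝒜 s J L) : Dominated 𝒜 s I L := by
  obtain ⟨H, h1, h2, h3, h4⟩ := h
  obtain ⟨H', h1', h2', h3', h4'⟩ := h'
  refine ⟨H * H', h1.mul h1', h2.mul h2', mul_ne_zero h3 h3', ?_⟩
  have a := s.coeSubmodule_mul_le h4 H'
  have b := s.coeSubmodule_mul_le h4' H
  rw [show I * (H * H') = H' * (I * H) by ring, show L * (H * H') = H * (L * H') by ring]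
  rw [show H * (J * H') = H' * (J * H) by ring] at b
  exact s.le_of_le_of_le a b

theorem mul (h : Dominated 𝒜 s I J) (h' : Dominated 𝒜 s L M) :
    Dominated 𝒜 s (I * L) (J * M) := by
  refine (h.mul_right L).trans ?_
  rw [mul_comm J L, mul_comm J M]
  exact h'.mul_right J

theorem sup (h : Dominated 𝒜 s I L) (h' : Dominated 𝒜 s J L) : Dominated 𝒜 s (I ⊔ J) L := by
  obtain ⟨H, h1, h2, h3, h4⟩ := h
  obtain ⟨H', h1', h2', h3', h4'⟩ := h'
  refine ⟨H * H', h1.mul h1', h2.mul h2', mul_ne_zero h3 h3', ?_⟩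
  rw [Ideal.sup_mul, IsLocalization.coeSubmodule_sup]
  refine sup_le ?_ ?_
  · have a := s.coeSubmodule_mul_le h4 H'
    rwa [show I * (H * H') = H' * (I * H) by ring, show L * (H * H') = H' * (L * H) by ring]
  · have a := s.coeSubmodule_mul_le h4' H
    rwa [show J * (H * H') = H * (J * H') by ring, show L * (H * H') = H * (L * H') by ring]

theorem cancel_right (hL : L.IsHomogeneous 𝒜) (hfg : L.FG) (h0 : L ≠ ⊥)
    (h : Dominated 𝒜 s (I * L) (J * L)) : Dominated 𝒜 s I J := by
  obtain ⟨H, h1, h2, h3, h4⟩ := h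
  refine ⟨L * H, hL.mul h1, hfg.mul h2, mul_ne_zero h0 h3, ?_⟩
  rwa [← mul_assoc, ← mul_assoc]

end Dominated

variable [IsDomain R] [IsAddTorsionFree Γ]

variable (𝒜) in
/-- The Dedekind–Mertens lemma, up to a common factor. -/
theorem dominated_content_mul (s : SemistarOperation R K) (f x : R) :
    Dominated 𝒜 s (content 𝒜 f * content 𝒜 x) (content 𝒜 (f * x)) := by
  induction hn : numComponents 𝒜 f + numComponents 𝒜 x using Nat.strong_induction_on
    generalizing f x with
  | _ n ih =>
  subst hn
  rcases eq_or_ne x 0 with rfl | hx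
  · exact .of_le (by simp)
  rcases eq_or_ne f 0 with rfl | hf
  · exact .of_le (by simp)
  obtain ⟨i, j, hi, hj, hij⟩ := exists_decompose_mul_eq 𝒜 hf hx
  have ih₁ := ih _ (Nat.add_lt_add_left (numComponents_sub_lt hj) _) f _ rfl
  have ih₂ := ih _ (Nat.add_lt_add_right (numComponents_sub_lt hi) _) _ x rfl
  have hca := content_le_sub_decompose_sup (𝒜 := 𝒜) f i
  have hcb := content_le_sub_decompose_sup (𝒜 := 𝒜) x j
  have ha' : Ideal.span {(DirectSum.decompose 𝒜 f i : R)} ≤ content 𝒜 f :=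
    (Ideal.span_singleton_le_iff_mem _).mpr (decompose_mem_content 𝒜 f i)
  have hb' : Ideal.span {(DirectSum.decompose 𝒜 x j : R)} ≤ content 𝒜 x :=
    (Ideal.span_singleton_le_iff_mem _).mpr (decompose_mem_content 𝒜 x j)
  have hca0 := content_of_isHomogeneousElem (𝒜 := 𝒜) (a := (DirectSum.decompose 𝒜 f i : R))
    ⟨i, SetLike.coe_mem _⟩
  have hcb0 := content_of_isHomogeneousElem (𝒜 := 𝒜) (a := (DirectSum.decompose 𝒜 x j : R))
    ⟨j, SetLike.coe_mem _⟩
  have hab : Ideal.span {(DirectSum.decompose 𝒜 f i : R)} *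
      Ideal.span {(DirectSum.decompose 𝒜 x j : R)} ≤ content 𝒜 (f * x) := by
    rw [Ideal.span_singleton_mul_span_singleton, Ideal.span_singleton_le_iff_mem, ← hij]
    exact decompose_mem_content 𝒜 _ _
  generalize (DirectSum.decompose 𝒜 f i : R) = a at *
  generalize (DirectSum.decompose 𝒜 x j : R) = b at *
  -- The induction gives C(f)C(x) ≺ C(fx) + C(f)b and, symmetrically, C(f)C(x) ≺ C(fx) + aC(x).
  -- Multiplying the two and using ab ∈ C(fx) gives (C(f)C(x))² ≺ C(fx)·C(f)C(x); then C(f)C(x) is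
  -- cancelled.
  have h₁ : Dominated 𝒜 s (content 𝒜 f * content 𝒜 x)
      (content 𝒜 (f * x) ⊔ content 𝒜 f * Ideal.span {b}) := by
    refine Dominated.trans (.of_le (Ideal.mul_mono_right hcb)) ?_
    rw [Ideal.mul_sup]
    refine .sup (ih₁.trans (.of_le ?_)) (.of_le le_sup_right)
    rw [mul_sub, sub_eq_add_neg]
    refine (content_add_le 𝒜 _ _).trans (sup_le_sup le_rfl ?_)
    rw [content_neg, ← hcb0]
    exact content_mul_le 𝒜 _ _
  have h₂ : Dominated 𝒜 s (content 𝒜 f * content 𝒜 x)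
      (content 𝒜 (f * x) ⊔ Ideal.span {a} * content 𝒜 x) := by
    refine Dominated.trans (.of_le (Ideal.mul_mono_left hca)) ?_
    rw [Ideal.sup_mul]
    refine .sup (ih₂.trans (.of_le ?_)) (.of_le le_sup_right)
    rw [sub_mul, sub_eq_add_neg]
    refine (content_add_le 𝒜 _ _).trans (sup_le_sup le_rfl ?_)
    rw [content_neg, ← hca0]
    exact content_mul_le 𝒜 _ _
  refine Dominated.cancel_right ((content_isHomogeneous 𝒜 f).mul (content_isHomogeneous 𝒜 x))
    ((content_fg 𝒜 f).mul (content_fg 𝒜 x))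
    (mul_ne_zero (content_ne_bot 𝒜 hf) (content_ne_bot 𝒜 hx)) ?_
  refine (h₁.mul h₂).trans (.of_le ?_)
  rw [Ideal.sup_mul, Ideal.mul_sup, Ideal.mul_sup]
  refine sup_le (sup_le ?_ ?_) (sup_le ?_ ?_)
  · exact Ideal.mul_mono_right (content_mul_le 𝒜 _ _)
  · exact Ideal.mul_mono_right (Ideal.mul_mono_left ha')
  · rw [mul_comm]
    exact Ideal.mul_mono_right (Ideal.mul_mono_right hb')
  · rw [show content 𝒜 f * Ideal.span {b} * (Ideal.span {a} * content 𝒜 x) =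
      (Ideal.span {a} * Ideal.span {b}) * (content 𝒜 f * content 𝒜 x) by ring]
    exact Ideal.mul_mono_left hab

end Dominated

end GradedDomain

/-! ### Comparison of ⋆ with ⋆̃. -/

namespace SemistarOperation

variable {R K : Type*} [CommRing R] [Field K] [Algebra R K]

theorem eq_one_of_le_of_eq_one (s : SemistarOperation R K) {I J : Ideal R}
    (h : IsLocalization.coeSubmodule K J ≤ s (IsLocalization.coeSubmodule K I))
    (hJ : s (IsLocalization.coeSubmodule K J) = s 1) :
    s (IsLocalization.coeSubmodule K I) = s 1 := by
  refine s.eq_one_of_mem (coeSubmodule_le_one I) ?_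
  have := s.mono' _ _ h
  rw [s.idem', hJ] at this
  exact this s.one_mem

variable [FaithfulSMul R K]

theorem tilde_le (s : SemistarOperation R K) (E : Submodule R K) : s.tilde E ≤ s E := by
  rintro x ⟨J, hJ, hx⟩
  rcases eq_or_ne x 0 with rfl | hx0
  · exact zero_mem _
  have h : x • IsLocalization.coeSubmodule K J ≤ E := by
    rintro _ ⟨_, ⟨y, hy, rfl⟩, rfl⟩
    exact hx y hy
  have h' := s.mono' _ _ h
  rw [s.smul' x hx0, hJ.2.2] at h'
  have := h' (Submodule.smul_mem_pointwise_smul _ x _ s.one_mem)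
  simpa using this

theorem IsDense.tilde_eq {s : SemistarOperation R K} {J : Ideal R} (hJ : s.IsDense J) :
    s.tilde (IsLocalization.coeSubmodule K J) = s.tilde 1 := by
  refine s.tilde.eq_one_of_mem (coeSubmodule_le_one J) ⟨J, hJ, fun y hy => ?_⟩
  rw [one_mul]
  exact ⟨y, hy, rfl⟩

end SemistarOperation

/-! ### Invertibility up to N_⋆(H). -/

namespace GradedDomain

variable {Γ R K : Type*} [AddCancelCommMonoid Γ] [DecidableEq Γ] [CommRing R]
variable {𝒜 : Γ → AddSubgroup R} [GradedRing 𝒜] [Field K] [Algebra R K]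

theorem span_singleton_mul_content_le {a : R} (ha : SetLike.IsHomogeneousElem 𝒜 a) (r : R) :
    Ideal.span {a} * content 𝒜 r ≤ content 𝒜 (a * r) := by
  obtain ⟨i, hi⟩ := ha
  rw [content, Ideal.span_mul_span', Ideal.span_le]
  rintro _ ⟨b, rfl, _, ⟨j, rfl⟩, rfl⟩
  have := decompose_mem_content 𝒜 (b * r) (i + j)
  rwa [DirectSum.coe_decompose_mul_add_of_left_mem 𝒜 hi] at this

theorem exists_isHomogeneousElem_mem {I : Ideal R} (hI : I.IsHomogeneous 𝒜) (h0 : I ≠ ⊥) :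
    ∃ a ∈ I, SetLike.IsHomogeneousElem 𝒜 a ∧ a ≠ 0 := by
  obtain ⟨x, hx, hx0⟩ := Submodule.exists_mem_ne_zero_of_ne_bot h0
  by_contra hcon
  push Not at hcon
  have : content 𝒜 x ≤ ⊥ := by
    refine Ideal.span_le.mpr ?_
    rintro _ ⟨α, rfl⟩
    exact hcon _ (hI α hx) ⟨α, SetLike.coe_mem _⟩
  exact content_ne_bot 𝒜 hx0 (eq_bot_iff.mpr this)

theorem mem_homogeneousQuotientField [IsDomain R] [IsFractionRing R K] {x : K} :
    x ∈ homogeneousQuotientField 𝒜 K ↔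
    ∃ h : R, SetLike.IsHomogeneousElem 𝒜 h ∧ h ≠ 0 ∧
      ∃ a : R, x * algebraMap R K h = algebraMap R K a := by
  change (∃ (a h : R) (_ : h ∈ homogeneousElements 𝒜),
    x = algebraMap R K a * (algebraMap R K h)⁻¹) ↔ _
  have h0 : ∀ g : R, g ≠ 0 → algebraMap R K g ≠ 0 := fun g hg => by simpa using hg
  constructor
  · rintro ⟨a, g, hg, rfl⟩
    exact ⟨g, hg.1, hg.2, a, by rw [inv_mul_cancel_right₀ (h0 g hg.2)]⟩
  · rintro ⟨g, hg, hg0, a, h⟩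
    exact ⟨a, g, ⟨hg, hg0⟩, by rw [← h, mul_inv_cancel_right₀ (h0 g hg0)]⟩

section

variable [IsAddTorsionFree Γ] {s : SemistarOperation R K}

theorem isDense_content {r : R} (hr : r ∈ nagataSet 𝒜 s) : s.IsDense (content 𝒜 r) :=
  ⟨content_fg 𝒜 r, s.ne_bot_of_eq_one hr, hr⟩

theorem mem_nagataSet_of_le {J : Ideal R} (hJ : s.IsDense J) {r : R}
    (h : IsLocalization.coeSubmodule K J ≤ s (IsLocalization.coeSubmodule K (content 𝒜 r))) :
    r ∈ nagataSet 𝒜 s :=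
  s.eq_one_of_le_of_eq_one h hJ.2.2

/-- Every dense ideal J meets N: an r ∈ J with J ⊆ C(r) has dense content. Denominator ideals of ⋆̃
can thus be replaced by single elements of N. -/
theorem exists_mem_nagataSet (hunit : ∃ α : Γ, α ≠ 0 ∧ ∃ u ∈ 𝒜 α, IsUnit u) {J : Ideal R}
    (hJ : s.IsDense J) : ∃ r ∈ J, r ∈ nagataSet 𝒜 s := by
  obtain ⟨r, hr, h⟩ := exists_mem_le_content 𝒜 hunit hJ.1
  exact ⟨r, hr, mem_nagataSet_of_le hJ ((Submodule.map_mono h).trans (s.le' _))⟩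

/-- The form in which the first Dedekind–Mertens lemma is used: as C(g^n) ⊆ C(g)^n, the element z =
g^n works. -/
theorem exists_content_mul_content_le {W : Ideal R} (hW : W.IsHomogeneous 𝒜) {g a : R}
    (hg : g ∈ nagataSet 𝒜 s) (h : g * a ∈ W) :
    ∃ z ∈ nagataSet 𝒜 s, content 𝒜 z * content 𝒜 a ≤ W := by
  obtain ⟨n, hn⟩ := exists_content_pow_mul_content_le hW h
  refine ⟨g ^ n, pow_mem hg n, (Ideal.mul_mono_left ?_).trans hn⟩
  clear hn
  induction n with
  | zero => simp
  | succ n ih =>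
    rw [pow_succ, pow_succ]
    exact (content_mul_le 𝒜 _ _).trans (Ideal.mul_mono_left ih)

variable (𝒜 s) in
/-- `I` is invertible up to elements of `N_⋆(H)`. -/
def IsNagataInvertible (I : Ideal R) : Prop :=
  ∃ a : R, a ≠ 0 ∧ ∃ B : Ideal R, ∃ r ∈ nagataSet 𝒜 s, I * B ≤ Ideal.span {a} ∧ a * r ∈ I * B

theorem IsNagataInvertible.mul [IsDomain R] {I I' : Ideal R} (h : IsNagataInvertible 𝒜 s I)
    (h' : IsNagataInvertible 𝒜 s I') : IsNagataInvertible 𝒜 s (I * I') := by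
  obtain ⟨a, ha, B, r, hr, h1, h2⟩ := h
  obtain ⟨a', ha', B', r', hr', h1', h2'⟩ := h'
  refine ⟨a * a', mul_ne_zero ha ha', B * B', r * r', mul_mem hr hr', ?_, ?_⟩
  · rw [mul_mul_mul_comm, ← Ideal.span_singleton_mul_span_singleton]
    exact Ideal.mul_mono h1 h1'
  · rw [mul_mul_mul_comm a, mul_mul_mul_comm I]
    exact Ideal.mul_mem_mul h2 h2'

theorem IsNagataInvertible.of_mul {I I' : Ideal R} (h : IsNagataInvertible 𝒜 s (I * I')) :
    IsNagataInvertible 𝒜 s I := by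
  obtain ⟨a, ha, B, r, hr, h1, h2⟩ := h
  rw [mul_assoc] at h1 h2
  exact ⟨a, ha, I' * B, r, hr, h1, h2⟩

theorem isNagataInvertible_span_singleton {a : R} (ha : a ≠ 0) :
    IsNagataInvertible 𝒜 s (Ideal.span {a}) :=
  ⟨a, ha, ⊤, 1, one_mem _, Ideal.mul_le_left, by simp⟩

variable [IsDomain R]

/-- Any c ∈ I can replace the given a: cB/a is contained in (c : I), so (c : I) serves as the
approximate inverse. -/
theorem IsNagataInvertible.mul_mem_mul_colon {I : Ideal R} (h : IsNagataInvertible 𝒜 s I) {c : R}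
    (hc : c ∈ I) :
    ∃ r ∈ nagataSet 𝒜 s, c * r ∈ I * (Ideal.span {c}).colon (I : Set R) := by
  obtain ⟨a, ha, B, r, hr, h1, h2⟩ := h
  have key : ∀ w ∈ I * B, ∃ q ∈ I * (Ideal.span {c}).colon (I : Set R), a * q = c * w := by
    intro w hw
    induction hw using Submodule.mul_induction_on' with
    | mem_mul_mem y hy b hb =>
      obtain ⟨b', hb'⟩ := Ideal.mem_span_singleton'.mp (h1 (Ideal.mul_mem_mul hc hb))
      refine ⟨y * b', Ideal.mul_mem_mul hy (Submodule.mem_colon.mpr fun v hv => ?_), by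
        linear_combination y * hb'⟩
      obtain ⟨d, hd⟩ := Ideal.mem_span_singleton'.mp (h1 (Ideal.mul_mem_mul hv hb))
      refine Ideal.mem_span_singleton'.mpr ⟨d, mul_left_cancel₀ ha ?_⟩
      rw [smul_eq_mul]
      linear_combination c * hd - v * hb'
    | add x _ y _ hx hy =>
      obtain ⟨q, hq, hq'⟩ := hx
      obtain ⟨p, hp, hp'⟩ := hy
      exact ⟨q + p, add_mem hq hp, by linear_combination hq' + hp'⟩
  obtain ⟨q, hq, hq'⟩ := key _ h2
  refine ⟨r, hr, ?_⟩
  rwa [← mul_left_cancel₀ ha (hq'.trans (by ring) : a * q = a * (c * r))]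

/-- With a homogeneous a ∈ I, the approximate inverse (a : I) is itself homogeneous; only finitely
many of its elements are needed, and they lie in the content of one y. The relation ar ∈ I C(y) then
spreads to all components of r. -/
theorem IsNagataInvertible.exists_content (hunit : ∃ α : Γ, α ≠ 0 ∧ ∃ u ∈ 𝒜 α, IsUnit u)
    {I : Ideal R} (hI : I.IsHomogeneous 𝒜) (h0 : I ≠ ⊥) (h : IsNagataInvertible 𝒜 s I) :
    ∃ a : R, SetLike.IsHomogeneousElem 𝒜 a ∧ a ≠ 0 ∧ ∃ y : R, ∃ r ∈ nagataSet 𝒜 s,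
      I * content 𝒜 y ≤ Ideal.span {a} ∧ Ideal.span {a} * content 𝒜 r ≤ I * content 𝒜 y := by
  obtain ⟨a, haI, hah, ha⟩ := exists_isHomogeneousElem_mem hI h0
  obtain ⟨r, hr, hmem⟩ := h.mul_mem_mul_colon haI
  obtain ⟨T, T', hT, hT', hmem'⟩ := Submodule.mem_span_mul_finite_of_mem_mul hmem
  rw [← Submodule.span_mul_span] at hmem'
  have hcol : ((Ideal.span {a}).colon (I : Set R)).IsHomogeneous 𝒜 :=
    colon_isHomogeneous (Ideal.homogeneous_span 𝒜 _ (by rintro _ rfl; exact hah)) hI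
  obtain ⟨y, hy, hy'⟩ := exists_mem_le_content 𝒜 hunit (J := Submodule.span R (T' : Set R))
    ⟨T', rfl⟩
  have hyc := (content_le_iff hcol).mpr (Submodule.span_le.mpr hT' hy)
  refine ⟨a, hah, ha, y, r, hr, ?_, (span_singleton_mul_content_le hah r).trans
    ((content_le_iff (hI.mul (content_isHomogeneous 𝒜 y))).mpr
      (Ideal.mul_mono (Submodule.span_le.mpr hT) hy' hmem'))⟩
  rw [mul_comm, Ideal.mul_le]
  exact fun b hb v hv => Submodule.mem_colon.mp (hyc hb) v hv

variable [IsFractionRing R K]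

theorem mem_nagataRing {x : K} : x ∈ nagataRing 𝒜 s ↔
    ∃ g ∈ nagataSet 𝒜 s, ∃ a : R, x * algebraMap R K g = algebraMap R K a := by
  change (∃ (a g : R) (_ : g ∈ nagataSet 𝒜 s),
    x = algebraMap R K a * (algebraMap R K g)⁻¹) ↔ _
  have h0 : ∀ g ∈ nagataSet 𝒜 s, algebraMap R K g ≠ 0 := fun g hg =>
    IsFractionRing.to_map_ne_zero_of_mem_nonZeroDivisors (nagataSet_le 𝒜 s hg)
  constructor
  · rintro ⟨a, g, hg, rfl⟩
    exact ⟨g, hg, a, by rw [inv_mul_cancel_right₀ (h0 g hg)]⟩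
  · rintro ⟨g, hg, a, h⟩
    exact ⟨a, g, hg, by rw [← h, mul_inv_cancel_right₀ (h0 g hg)]⟩

theorem exists_mul_mem_of_mem_tilde (hunit : ∃ α : Γ, α ≠ 0 ∧ ∃ u ∈ 𝒜 α, IsUnit u)
    {E : Submodule R K} {x : K} (hx : x ∈ s.tilde E) :
    ∃ g ∈ nagataSet 𝒜 s, x * algebraMap R K g ∈ E := by
  obtain ⟨J, hJ, hx⟩ := hx
  obtain ⟨g, hgJ, hg⟩ := exists_mem_nagataSet hunit hJ
  exact ⟨g, hg, hx g hgJ⟩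

theorem tilde_one_le_nagataRing (hunit : ∃ α : Γ, α ≠ 0 ∧ ∃ u ∈ 𝒜 α, IsUnit u) {x : K}
    (hx : x ∈ s.tilde 1) : x ∈ nagataRing 𝒜 s := by
  obtain ⟨g, hg, h⟩ := exists_mul_mem_of_mem_tilde hunit hx
  obtain ⟨a, ha⟩ := Submodule.mem_one.mp h
  exact mem_nagataRing.mpr ⟨g, hg, a, ha.symm⟩

/-- If x = b/g = a/h with g ∈ N and h homogeneous, then ga ∈ (h), so Dedekind–Mertens gives C(z)C(a)
⊆ (h) for some z ∈ N, and hence x C(z) ⊆ R. -/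
theorem mem_tilde_one_of_mem {x : K} (hx : x ∈ nagataRing 𝒜 s)
    (hx' : x ∈ homogeneousQuotientField 𝒜 K) : x ∈ s.tilde 1 := by
  obtain ⟨g, hg, b, hb⟩ := mem_nagataRing.mp hx
  obtain ⟨h, hh, h0, a, ha⟩ := mem_homogeneousQuotientField.mp hx'
  have hmem : g * a ∈ Ideal.span {h} := by
    refine Ideal.mem_span_singleton'.mpr ⟨b, FaithfulSMul.algebraMap_injective R K ?_⟩
    rw [map_mul, map_mul, ← ha, ← hb]
    ring
  obtain ⟨z, hz, hle⟩ := exists_content_mul_content_le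
    (Ideal.homogeneous_span 𝒜 _ (by rintro _ rfl; exact hh)) hg hmem
  refine ⟨content 𝒜 z, isDense_content hz, fun y hy => ?_⟩
  obtain ⟨d, hd⟩ := Ideal.mem_span_singleton'.mp
    (hle (Ideal.mul_mem_mul hy (mem_content_self 𝒜 a)))
  refine Submodule.mem_one.mpr ⟨d, ?_⟩
  have h0' : algebraMap R K h ≠ 0 := by simpa using h0
  have := congrArg (algebraMap R K) hd
  rw [map_mul, map_mul, ← ha] at this
  exact mul_right_cancel₀ h0' (this.trans (by ring))

/-- Finite type brings 1 into F^⋆ for one finitely generated F ⊆ II⁻¹. Such an F is a dense ideal,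
so II⁻¹ contains an element of N. Conversely, the homogeneous approximate inverse places a whole
dense content C(r) in II⁻¹. -/
theorem isGradedPStarMD_iff (hunit : ∃ α : Γ, α ≠ 0 ∧ ∃ u ∈ 𝒜 α, IsUnit u) :
    IsGradedPStarMD 𝒜 s ↔
      ∀ I : Ideal R, I.IsHomogeneous 𝒜 → I.FG → I ≠ ⊥ → IsNagataInvertible 𝒜 s I := by
  refine forall₄_congr fun I hI hfg h0 => ⟨fun h => ?_, fun h => ?_⟩
  · have hF : ∃ F : Submodule R K, F.FG ∧ F ≤ IsLocalization.coeSubmodule K I *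
        (1 / IsLocalization.coeSubmodule K I) ∧ (1 : K) ∈ s F := by
      have h1 : (1 : K) ∈ s 1 := s.one_mem
      rw [← h, SemistarOperation.finiteType] at h1
      generalize (1 : K) = x at h1
      induction h1 using Submodule.iSup_induction' with
      | mem F x hx => exact ⟨F.1, F.2.1, F.2.2.2, hx⟩
      | zero => exact ⟨⊥, Submodule.fg_bot, bot_le, zero_mem _⟩
      | add x y _ _ hx hy =>
        obtain ⟨F, hF, hFE, hx⟩ := hx
        obtain ⟨G, hG, hGE, hy⟩ := hy
        exact ⟨F ⊔ G, hF.sup hG, sup_le hFE hGE,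
          add_mem (s.mono' _ _ le_sup_left hx) (s.mono' _ _ le_sup_right hy)⟩
    obtain ⟨F, hF, hFE, h1⟩ := hF
    have hF1 : F ≤ 1 := hFE.trans Submodule.mul_one_div_le_one
    obtain ⟨J, rfl⟩ : ∃ J : Ideal R, IsLocalization.coeSubmodule K J = F := by
      refine ⟨F.comap (Algebra.linearMap R K), Submodule.map_comap_eq_of_le ?_⟩
      rwa [← Submodule.one_eq_range]
    have hJ : s.IsDense J := by
      have := s.eq_one_of_mem hF1 h1
      exact ⟨(IsLocalization.coeSubmodule_fg K (FaithfulSMul.algebraMap_injective R K) J).mp hF,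
        s.ne_bot_of_eq_one this, this⟩
    obtain ⟨r, hrJ, hr⟩ := exists_mem_nagataSet hunit hJ
    obtain ⟨a, haI, ha⟩ := Submodule.exists_mem_ne_zero_of_ne_bot h0
    refine ⟨a, ha, (Ideal.span {a}).colon (I : Set R), r, hr, ?_, ?_⟩
    · rw [mul_comm, Ideal.mul_le]
      exact fun b hb v hv => Submodule.mem_colon.mp hb v hv
    have key : ∀ w ∈ IsLocalization.coeSubmodule K I * (1 / IsLocalization.coeSubmodule K I),
        ∃ q ∈ I * (Ideal.span {a}).colon (I : Set R), algebraMap R K q = algebraMap R K a * w := by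
      intro w hw
      induction hw using Submodule.mul_induction_on' with
      | mem_mul_mem y hy x hx =>
        obtain ⟨y, hy, rfl⟩ := hy
        rw [Submodule.mem_div_iff_forall_mul_mem] at hx
        obtain ⟨b, hb⟩ := Submodule.mem_one.mp (hx (algebraMap R K a) ⟨a, haI, rfl⟩)
        refine ⟨y * b, Ideal.mul_mem_mul hy (Submodule.mem_colon.mpr fun v hv => ?_), ?_⟩
        · obtain ⟨d, hd⟩ := Submodule.mem_one.mp (hx (algebraMap R K v) ⟨v, hv, rfl⟩)
          refine Ideal.mem_span_singleton'.mpr ⟨d, FaithfulSMul.algebraMap_injective R K ?_⟩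
          rw [smul_eq_mul, map_mul, map_mul, hb, hd]
          ring
        · rw [map_mul, hb, Algebra.linearMap_apply]
          ring
      | add x _ y _ hx hy =>
        obtain ⟨q, hq, hq'⟩ := hx
        obtain ⟨p, hp, hp'⟩ := hy
        exact ⟨q + p, add_mem hq hp, by rw [map_add, hq', hp', mul_add]⟩
    obtain ⟨q, hq, hq'⟩ := key _ (hFE ⟨r, hrJ, rfl⟩)
    rw [Algebra.linearMap_apply, ← map_mul] at hq'
    rwa [← FaithfulSMul.algebraMap_injective R K hq']
  · obtain ⟨a, -, ha, y, r, hr, h1, h2⟩ := h.exists_content hunit hI h0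
    have ha' : algebraMap R K a ≠ 0 := by simpa using ha
    refine le_antisymm (iSup_le fun F => s.mono' _ _
      (F.2.2.2.trans Submodule.mul_one_div_le_one)) ?_
    have key : ∀ w ∈ I * content 𝒜 y, algebraMap R K w / algebraMap R K a ∈
        IsLocalization.coeSubmodule K I * (1 / IsLocalization.coeSubmodule K I) := by
      intro w hw
      induction hw using Submodule.mul_induction_on' with
      | mem_mul_mem p hp b hb =>
        rw [map_mul, mul_div_assoc]
        refine Submodule.mul_mem_mul ⟨p, hp, rfl⟩ ?_
        rw [Submodule.mem_div_iff_forall_mul_mem]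
        rintro _ ⟨v, hv, rfl⟩
        obtain ⟨d, hd⟩ := Ideal.mem_span_singleton'.mp (h1 (Ideal.mul_mem_mul hv hb))
        refine Submodule.mem_one.mpr ⟨d, ?_⟩
        rw [Algebra.linearMap_apply, div_mul_eq_mul_div, eq_div_iff ha', ← map_mul, ← map_mul, hd,
          mul_comm]
      | add x _ y _ hx hy =>
        rw [map_add, add_div]
        exact add_mem hx hy
    have hle : IsLocalization.coeSubmodule K (content 𝒜 r) ≤
        IsLocalization.coeSubmodule K I * (1 / IsLocalization.coeSubmodule K I) := by
      rintro _ ⟨v, hv, rfl⟩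
      have := key _ (h2 (Ideal.mul_mem_mul (Ideal.mem_span_singleton_self a) hv))
      rwa [map_mul, mul_div_cancel_left₀ _ ha'] at this
    refine hr.symm.le.trans (le_iSup_of_le ⟨IsLocalization.coeSubmodule K (content 𝒜 r),
      (IsLocalization.coeSubmodule_fg K (FaithfulSMul.algebraMap_injective R K) _).mpr
        (content_fg 𝒜 r), fun h => ?_, hle⟩ le_rfl)
    have := hr
    rw [nagataSet, Submonoid.mem_mk, Subsemigroup.mem_mk] at this
    change s (IsLocalization.coeSubmodule K (content 𝒜 r)) = s 1 at this
    rw [h, s.bot'] at this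
    have h1 := s.one_mem
    rw [← this] at h1
    simp at h1

end

end GradedDomain

/-! ### Ideals of the graded Nagata ring T. -/

namespace GradedDomain

variable {Γ R K : Type*} [AddCancelCommMonoid Γ] [DecidableEq Γ] [CommRing R]
variable {𝒜 : Γ → AddSubgroup R} [GradedRing 𝒜] [Field K] [Algebra R K]
variable [IsDomain R] [IsFractionRing R K]

theorem coeSubmodule_span_singleton_mul (a : R) (A : Ideal R) :
    IsLocalization.coeSubmodule K (Ideal.span {a} * A) =
      algebraMap R K a • IsLocalization.coeSubmodule K A := by
  rw [IsLocalization.coeSubmodule_mul, IsLocalization.coeSubmodule_span_singleton,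
    Submodule.span_singleton_mul]

theorem _root_.SemistarOperation.le_of_span_singleton_mul_le (s : SemistarOperation R K) {a : R}
    (ha : a ≠ 0) {A B : Ideal R}
    (h : IsLocalization.coeSubmodule K (Ideal.span {a} * A) ≤
      s (IsLocalization.coeSubmodule K (Ideal.span {a} * B))) :
    IsLocalization.coeSubmodule K A ≤ s (IsLocalization.coeSubmodule K B) := by
  have ha' : algebraMap R K a ≠ 0 := by simpa using ha
  rw [coeSubmodule_span_singleton_mul, coeSubmodule_span_singleton_mul, s.smul' _ ha'] at h
  intro x hx
  have := h (Submodule.smul_mem_pointwise_smul _ (algebraMap R K a) _ hx)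
  rw [SemistarOperation.mem_smul_iff ha', smul_eq_mul, inv_mul_cancel_left₀ ha'] at this
  exact this

variable [IsAddTorsionFree Γ] {s : SemistarOperation R K}

instance : IsLocalization (nagataSet 𝒜 s) (nagataRing 𝒜 s) :=
  Localization.subalgebra.isLocalization_ofField K _ (nagataSet_le 𝒜 s)

/-- Once H is invertible up to N, it can be cancelled at the cost of a dense factor C(r). -/
theorem Dominated.exists_coeSubmodule_le (hunit : ∃ α : Γ, α ≠ 0 ∧ ∃ u ∈ 𝒜 α, IsUnit u)
    (hinv : ∀ I : Ideal R, I.IsHomogeneous 𝒜 → I.FG → I ≠ ⊥ → IsNagataInvertible 𝒜 s I)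
    {A B : Ideal R} (h : Dominated 𝒜 s A B) :
    ∃ r ∈ nagataSet 𝒜 s, IsLocalization.coeSubmodule K (content 𝒜 r * A) ≤
      s (IsLocalization.coeSubmodule K B) := by
  obtain ⟨H, h1, h2, h3, h4⟩ := h
  obtain ⟨a, -, ha, y, r, hr, hle, hge⟩ := (hinv H h1 h2 h3).exists_content hunit h1 h3
  refine ⟨r, hr, s.le_of_span_singleton_mul_le ha ?_⟩
  have := s.coeSubmodule_mul_le h4 (content 𝒜 y)
  refine le_trans (Submodule.map_mono ?_) (this.trans (s.mono' _ _ (Submodule.map_mono ?_)))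
  · rw [← mul_assoc, show content 𝒜 y * (A * H) = H * content 𝒜 y * A by ring]
    exact Ideal.mul_mono_left hge
  · rw [show content 𝒜 y * (B * H) = H * content 𝒜 y * B by ring]
    exact Ideal.mul_mono_left hle

theorem map_content_eq_span_of_forall_isNagataInvertible
    (hunit : ∃ α : Γ, α ≠ 0 ∧ ∃ u ∈ 𝒜 α, IsUnit u)
    (hinv : ∀ I : Ideal R, I.IsHomogeneous 𝒜 → I.FG → I ≠ ⊥ → IsNagataInvertible 𝒜 s I) (f : R) :
    (content 𝒜 f).map (algebraMap R (nagataRing 𝒜 s)) =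
      Ideal.span {algebraMap R (nagataRing 𝒜 s) f} := by
  refine le_antisymm ?_ ((Ideal.span_singleton_le_iff_mem _).mpr
    (Ideal.mem_map_of_mem _ (mem_content_self 𝒜 f)))
  rcases eq_or_ne f 0 with rfl | hf
  · simp
  have hC := content_isHomogeneous 𝒜 f
  have h0 := content_ne_bot 𝒜 hf
  obtain ⟨a, hah, ha, y, r, hr, hle, hge⟩ :=
    (hinv _ hC (content_fg 𝒜 f) h0).exists_content hunit hC h0
  -- Here fy = za. From aC(r) ⊆ C(f)C(y) ≺ C(fy) = C(za) ⊆ C(z)a it follows that C(r) ≺ C(z), so z ∈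
  -- N.
  obtain ⟨z, hz⟩ := Ideal.mem_span_singleton'.mp
    (hle (Ideal.mul_mem_mul (mem_content_self 𝒜 f) (mem_content_self 𝒜 y)))
  have hspan : (Ideal.span {a}).IsHomogeneous 𝒜 :=
    Ideal.homogeneous_span 𝒜 _ (by rintro _ rfl; exact hah)
  have hdom : Dominated 𝒜 s (content 𝒜 r) (content 𝒜 z) := by
    refine Dominated.cancel_right hspan (Submodule.fg_span_singleton a) (by simpa using ha) ?_
    rw [mul_comm]
    refine Dominated.trans (.of_le hge) ((dominated_content_mul 𝒜 s f y).trans (.of_le ?_))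
    rw [← hz, ← content_of_isHomogeneousElem hah]
    exact content_mul_le 𝒜 z a
  obtain ⟨r', hr', hle'⟩ := hdom.exists_coeSubmodule_le hunit hinv
  have hzN : z ∈ nagataSet 𝒜 s :=
    mem_nagataSet_of_le ((isDense_content hr').mul (isDense_content hr)) hle'
  rw [Ideal.map_le_iff_le_comap]
  intro c hc
  obtain ⟨d, hd⟩ := Ideal.mem_span_singleton'.mp
    (hle (Ideal.mul_mem_mul hc (mem_content_self 𝒜 y)))
  -- With cy = da, multiplying by f gives cza = dfa; as z becomes a unit in T, this puts c in fT.
  have hcz : c * z = d * f := mul_right_cancel₀ ha (by linear_combination c * hz - f * hd)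
  have hu := IsLocalization.map_units (nagataRing 𝒜 s) ⟨z, hzN⟩
  rw [Ideal.mem_comap, ← Ideal.mul_unit_mem_iff_mem _ hu, ← map_mul, hcz, map_mul]
  exact Ideal.mul_mem_left _ _ (Ideal.mem_span_singleton_self _)

/-- The homogeneous ideal is the sum of the contents of the elements of A ∩ R; since C(f)T = fT,
passing to contents adds nothing after extension. -/
theorem exists_isHomogeneous_map_eq
    (hG : ∀ f : R, (content 𝒜 f).map (algebraMap R (nagataRing 𝒜 s)) =
      Ideal.span {algebraMap R (nagataRing 𝒜 s) f}) (A : Ideal (nagataRing 𝒜 s)) :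
    ∃ I : Ideal R, I.IsHomogeneous 𝒜 ∧ A = I.map (algebraMap R (nagataRing 𝒜 s)) := by
  refine ⟨⨆ f : A.under R, content 𝒜 f.1,
    Ideal.IsHomogeneous.iSup fun f => content_isHomogeneous 𝒜 f.1, ?_⟩
  rw [Ideal.map_iSup]
  refine le_antisymm ?_ (iSup_le fun f => ?_)
  · rw [← IsLocalization.map_under (nagataSet 𝒜 s) (nagataRing 𝒜 s) A,
      Ideal.map_le_iff_le_comap]
    intro f hf
    rw [Ideal.mem_comap]
    rw [IsLocalization.map_under (nagataSet 𝒜 s)]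
    exact le_iSup (fun f : A.under R =>
      (content 𝒜 f.1).map (algebraMap R (nagataRing 𝒜 s))) ⟨f, hf⟩
      (Ideal.mem_map_of_mem _ (mem_content_self 𝒜 f))
  · rw [hG, Ideal.span_singleton_le_iff_mem]
    exact f.2

/-- If fT = IT with I homogeneous, then mf ∈ I for some m ∈ N, and Dedekind–Mertens gives C(z)C(f) ⊆
I with z ∈ N. -/
theorem map_content_eq_span_of_isPrincipal
    (h : ∀ A : Ideal (nagataRing 𝒜 s), A.IsPrincipal → ∃ I : Ideal R,
      I.IsHomogeneous 𝒜 ∧ A = I.map (algebraMap R (nagataRing 𝒜 s))) (f : R) :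
    (content 𝒜 f).map (algebraMap R (nagataRing 𝒜 s)) =
      Ideal.span {algebraMap R (nagataRing 𝒜 s) f} := by
  refine le_antisymm ?_ ((Ideal.span_singleton_le_iff_mem _).mpr
    (Ideal.mem_map_of_mem _ (mem_content_self 𝒜 f)))
  obtain ⟨I, hI, hfI⟩ := h (Ideal.span {algebraMap R (nagataRing 𝒜 s) f}) ⟨⟨_, rfl⟩⟩
  have hmem : algebraMap R (nagataRing 𝒜 s) f ∈ I.map (algebraMap R (nagataRing 𝒜 s)) := by
    rw [← hfI]; exact Ideal.mem_span_singleton_self _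
  rw [IsLocalization.algebraMap_mem_map_algebraMap_iff (nagataSet 𝒜 s)] at hmem
  obtain ⟨m, hm, hmf⟩ := hmem
  obtain ⟨z, hz, hle⟩ := exists_content_mul_content_le hI hm hmf
  rw [hfI, Ideal.map_le_iff_le_comap]
  intro c hc
  rw [Ideal.mem_comap, IsLocalization.algebraMap_mem_map_algebraMap_iff (nagataSet 𝒜 s)]
  exact ⟨z, hz, hle (Ideal.mul_mem_mul (mem_content_self 𝒜 z) hc)⟩

/-- Elements of T are elements of R up to units, and fT + gT = (C(f) + C(g))T = C(f + gv)T = (f +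
gv)T. -/
theorem isBezout_nagataRing (hunit : ∃ α : Γ, α ≠ 0 ∧ ∃ u ∈ 𝒜 α, IsUnit u)
    (hG : ∀ f : R, (content 𝒜 f).map (algebraMap R (nagataRing 𝒜 s)) =
      Ideal.span {algebraMap R (nagataRing 𝒜 s) f}) : IsBezout (nagataRing 𝒜 s) := by
  have key : ∀ x : nagataRing 𝒜 s, ∃ f : R,
      Ideal.span {x} = Ideal.span {algebraMap R (nagataRing 𝒜 s) f} := by
    intro x
    obtain ⟨⟨f, z⟩, hfz⟩ := IsLocalization.surj (nagataSet 𝒜 s) x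
    refine ⟨f, ?_⟩
    rw [← hfz]
    exact (Ideal.span_singleton_mul_right_unit
      (IsLocalization.map_units (nagataRing 𝒜 s) z) x).symm
  rw [IsBezout.iff_span_pair_isPrincipal]
  intro x y
  obtain ⟨f, hf⟩ := key x
  obtain ⟨g, hg⟩ := key y
  obtain ⟨v, -, hv, -⟩ := exists_isUnit_content_add_mul 𝒜 hunit f g
  refine ⟨⟨algebraMap R (nagataRing 𝒜 s) (f + g * v), ?_⟩⟩
  change _ = Ideal.span _
  rw [Ideal.span_insert, ← hG, hv, Ideal.map_sup, hG, hG, ← hf, ← hg]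

theorem _root_.IsBezout.isPruferDomain {D : Type*} [CommRing D] [IsDomain D] [IsBezout D] :
    IsPruferDomain D := by
  refine ⟨inferInstance, fun I hI h0 => ?_⟩
  obtain ⟨⟨a, ha⟩⟩ := IsBezout.isPrincipal_of_FG I hI
  obtain rfl : I = Ideal.span {a} := ha
  have ha0 : a ≠ 0 := by simpa using h0
  have ha' : algebraMap D (FractionRing D) a ≠ 0 := by simpa using ha0
  rw [FractionalIdeal.coeIdeal_span_singleton]
  exact IsUnit.of_mul_eq_one (FractionalIdeal.spanSingleton D⁰ (algebraMap D (FractionRing D) a)⁻¹)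
    (by rw [FractionalIdeal.spanSingleton_mul_spanSingleton, mul_inv_cancel₀ ha',
      FractionalIdeal.spanSingleton_one])

theorem _root_.IsPruferDomain.exists_mul_eq_span_singleton {D : Type*} [CommRing D]
    (hD : IsPruferDomain D) {A : Ideal D} (hA : A.FG) {a : D} (ha : a ∈ A) (ha0 : a ≠ 0) :
    ∃ B : Ideal D, A * B = Ideal.span {a} := by
  have := hD.1
  obtain ⟨u, hu⟩ := hD.2 A hA (by rintro rfl; exact ha0 (by simpa using ha))
  have hle : (Ideal.span {a} : FractionalIdeal D⁰ (FractionRing D)) ≤ u := by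
    rw [hu, FractionalIdeal.coeIdeal_le_coeIdeal]
    exact (Ideal.span_singleton_le_iff_mem _).mpr ha
  obtain ⟨B, hB⟩ := FractionalIdeal.le_one_iff_exists_coeIdeal.mp
    (show ((u⁻¹ : (FractionalIdeal D⁰ (FractionRing D))ˣ) : FractionalIdeal D⁰ (FractionRing D)) *
      (Ideal.span {a} : Ideal D) ≤ 1 by
      rw [← u.inv_mul]
      exact mul_le_mul_right hle _)
  refine ⟨B, FractionalIdeal.coeIdeal_injective (K := FractionRing D) ?_⟩
  change ((A * B : Ideal D) : FractionalIdeal D⁰ (FractionRing D)) = (Ideal.span {a} : Ideal D)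
  rw [FractionalIdeal.coeIdeal_mul, hB, ← hu, Units.mul_inv_cancel_left]

theorem isNagataInvertible_of_isPruferDomain (hT : IsPruferDomain (nagataRing 𝒜 s)) {I : Ideal R}
    (hfg : I.FG) (h0 : I ≠ ⊥) : IsNagataInvertible 𝒜 s I := by
  obtain ⟨a, haI, ha⟩ := Submodule.exists_mem_ne_zero_of_ne_bot h0
  have hinj : Function.Injective (algebraMap R (nagataRing 𝒜 s)) :=
    IsLocalization.injective _ (nagataSet_le 𝒜 s)
  obtain ⟨B, hB⟩ := hT.exists_mul_eq_span_singleton (hfg.map (algebraMap R (nagataRing 𝒜 s)))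
    (Ideal.mem_map_of_mem _ haI) (by simpa using (map_ne_zero_iff _ hinj).mpr ha)
  rw [← IsLocalization.map_under (nagataSet 𝒜 s) (nagataRing 𝒜 s) B, ← Ideal.map_mul] at hB
  set B₀ := B.under R
  have hmem : algebraMap R (nagataRing 𝒜 s) a ∈
      (I * B₀).map (algebraMap R (nagataRing 𝒜 s)) := by
    rw [hB]; exact Ideal.mem_span_singleton_self _
  rw [IsLocalization.algebraMap_mem_map_algebraMap_iff (nagataSet 𝒜 s)] at hmem
  obtain ⟨r, hr, hra⟩ := hmem
  obtain ⟨T, T', hT, hT', hmem'⟩ := Submodule.mem_span_mul_finite_of_mem_mul hra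
  rw [← Submodule.span_mul_span] at hmem'
  -- The inclusion IB₀ ⊆ aR holds only in T. For a finitely generated part of IB₀ a common
  -- denominator m ∈ N restores it in R, and a finitely generated part of B₀ suffices for ra ∈ IB₀.
  have hB₁ : ∀ M : Ideal R, M.FG → M ≤ I * B₀ →
      ∃ m ∈ nagataSet 𝒜 s, Ideal.span {m} * M ≤ Ideal.span {a} := by
    intro M hM hle
    induction M, hM using Submodule.fg_induction with
    | singleton c =>
      have hc : algebraMap R (nagataRing 𝒜 s) c ∈
          (Ideal.span {a}).map (algebraMap R (nagataRing 𝒜 s)) := by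
        rw [Ideal.map_span, Set.image_singleton, ← hB]
        exact Ideal.mem_map_of_mem _ (hle (Submodule.mem_span_singleton_self c))
      rw [IsLocalization.algebraMap_mem_map_algebraMap_iff (nagataSet 𝒜 s)] at hc
      obtain ⟨m, hm, hmc⟩ := hc
      refine ⟨m, hm, ?_⟩
      rw [Ideal.submodule_span_eq, Ideal.span_singleton_mul_span_singleton]
      exact (Ideal.span_singleton_le_iff_mem _).mpr hmc
    | sup M₁ M₂ _ _ h₁ h₂ =>
      obtain ⟨m₁, hm₁, h₁⟩ := h₁ (le_sup_left.trans hle)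
      obtain ⟨m₂, hm₂, h₂⟩ := h₂ (le_sup_right.trans hle)
      refine ⟨m₁ * m₂, mul_mem hm₁ hm₂, ?_⟩
      rw [← Ideal.span_singleton_mul_span_singleton, Ideal.mul_sup]
      refine sup_le ?_ ?_
      · rw [mul_comm (Ideal.span {m₁}), mul_assoc]
        exact Ideal.mul_le_right.trans h₁
      · rw [mul_assoc]
        exact Ideal.mul_le_right.trans h₂
  obtain ⟨m, hm, hma⟩ := hB₁ (I * Submodule.span R (T' : Set R)) (hfg.mul ⟨T', rfl⟩)
    (Ideal.mul_mono_right (Submodule.span_le.mpr hT'))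
  refine ⟨a, ha, Ideal.span {m} * Submodule.span R (T' : Set R), r * m, mul_mem hr hm, ?_, ?_⟩
  · rwa [mul_left_comm]
  · rw [mul_left_comm, show a * (r * m) = m * (r * a) by ring]
    exact Ideal.mul_mem_mul (Ideal.mem_span_singleton_self m)
      (Ideal.mul_mono_left (Submodule.span_le.mpr hT) hmem')

end GradedDomain

/-! ### The Kronecker function ring and flatness. -/

/-- Cayley–Hamilton: multiplication by j maps H into IH, so a monic polynomial with lower
coefficients in I kills H at j. In a domain it vanishes at j, so a power of j lies in I. -/
theorem Ideal.le_radical_of_mul_le_mul {R : Type*} [CommRing R] [IsDomain R] {I J H : Ideal R}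
    (hfg : H.FG) (h0 : H ≠ ⊥) (h : J * H ≤ I * H) : J ≤ I.radical := by
  intro j hj
  have : Module.Finite R H := Module.Finite.iff_fg.mpr hfg
  obtain ⟨p, hp, -, hcoeff, haeval⟩ :=
    LinearMap.exists_monic_and_natDegree_eq_and_coeff_mem_pow_and_aeval_eq_zero R
      (algebraMap R (Module.End R H) j) I (by
        rintro _ ⟨x, rfl⟩
        rw [Submodule.mem_smul_top_iff]
        exact h (Ideal.mul_mem_mul hj x.2))
  obtain ⟨x, hx, hx0⟩ := Submodule.exists_mem_ne_zero_of_ne_bot h0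
  have heval : p.eval j = 0 := by
    rw [Polynomial.aeval_algebraMap_apply] at haeval
    have := congrArg Subtype.val (LinearMap.congr_fun haeval ⟨x, hx⟩)
    simpa [hx0] using this
  refine ⟨p.natDegree, ?_⟩
  rw [Polynomial.eval_eq_sum_range, Finset.sum_range_succ, hp.coeff_natDegree, one_mul] at heval
  rw [eq_neg_of_add_eq_zero_right heval]
  refine neg_mem (Ideal.sum_mem _ fun k hk => Ideal.mul_mem_right _ _ ?_)
  exact Ideal.pow_le_self (Nat.sub_ne_zero_of_lt (Finset.mem_range.mp hk)) (hcoeff k)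

/-- The equational criterion for the relation g·x − f·1 = 0 writes 1 = ∑ a₁ⱼ yⱼ with g a₀ⱼ = f a₁ⱼ,
that is, a₁ⱼ ∈ (g : f). -/
theorem Module.Flat.map_colon_singleton_eq_top {R B : Type*} [CommRing R] [CommRing B]
    [Algebra R B] [Module.Flat R B] {f g : R} {x : B}
    (h : algebraMap R B g * x = algebraMap R B f) :
    ((Ideal.span {g}).colon {f}).map (algebraMap R B) = ⊤ := by
  obtain ⟨k, a, y, h1, h2⟩ := Module.Flat.isTrivialRelation_of_sum_smul_eq_zero
    (R := R) (M := B) (f := ![g, -f]) (x := ![x, 1]) (by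
      simp [Fin.sum_univ_two, Algebra.smul_def, h])
  rw [Ideal.eq_top_iff_one]
  have h11 := h1 1
  simp only [Matrix.cons_val_one, Matrix.cons_val_fin_one] at h11
  rw [h11]
  refine Ideal.sum_mem _ fun j _ => ?_
  rw [Algebra.smul_def]
  refine Ideal.mul_mem_right _ _ (Ideal.mem_map_of_mem _ ?_)
  rw [Submodule.mem_colon_singleton]
  have h2j := h2 j
  simp only [Fin.sum_univ_two, Matrix.cons_val_zero, Matrix.cons_val_one,
    Matrix.cons_val_fin_one] at h2j
  exact Ideal.mem_span_singleton'.mpr ⟨a 0 j, by rw [smul_eq_mul]; linear_combination h2j⟩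

theorem Ideal.exists_fg_le_map_eq_top {R B : Type*} [CommRing R] [CommRing B] [Algebra R B]
    {Q : Ideal R} (h : Q.map (algebraMap R B) = ⊤) :
    ∃ D : Ideal R, D.FG ∧ D ≤ Q ∧ D.map (algebraMap R B) = ⊤ := by
  classical
  rw [Ideal.eq_top_iff_one, Ideal.map] at h
  obtain ⟨T, hT, h1⟩ := Submodule.mem_span_finite_of_mem_span h
  obtain ⟨S, hS, hST⟩ := Finset.subset_set_image_iff.mp hT
  refine ⟨Ideal.span S, ⟨S, rfl⟩, Ideal.span_le.mpr hS, ?_⟩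
  rw [Ideal.eq_top_iff_one, Ideal.map_span]
  rwa [← hST, Finset.coe_image] at h1

namespace GradedDomain

variable {Γ R K : Type*} [AddCancelCommMonoid Γ] [DecidableEq Γ] [CommRing R]
variable {𝒜 : Γ → AddSubgroup R} [GradedRing 𝒜] [Field K] [Algebra R K]
variable [IsDomain R] [IsFractionRing R K] [IsAddTorsionFree Γ] {s t : SemistarOperation R K}

theorem mem_kroneckerSet_iff (hunit : ∃ α : Γ, α ≠ 0 ∧ ∃ u ∈ 𝒜 α, IsUnit u) {x : K} :
    x ∈ kroneckerSet 𝒜 t ↔ ∃ f g : R, g ≠ 0 ∧ x = algebraMap R K f / algebraMap R K g ∧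
      Dominated 𝒜 t (content 𝒜 f) (content 𝒜 g) := by
  refine exists₂_congr fun f g => and_congr_right fun hg => and_congr_right fun hx => ⟨?_, ?_⟩
  · rintro ⟨h, h0, hle⟩
    exact ⟨content 𝒜 h, content_isHomogeneous 𝒜 h, content_fg 𝒜 h, content_ne_bot 𝒜 h0, hle⟩
  · rintro ⟨H, h1, h2, h3, h4⟩
    obtain ⟨h, rfl⟩ := exists_content_eq hunit h1 h2
    exact ⟨h, by rintro rfl; simp at h3, h4⟩

/-- If f/g = f'/g', then C(f)C(g') ≺ C(fg') = C(f'g) ≺ C(g)C(g') by Dedekind–Mertens, and C(g')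
cancels. So membership does not depend on the representing fraction. -/
theorem div_mem_kroneckerSet_iff (hunit : ∃ α : Γ, α ≠ 0 ∧ ∃ u ∈ 𝒜 α, IsUnit u) {f g : R}
    (hg : g ≠ 0) : algebraMap R K f / algebraMap R K g ∈ kroneckerSet 𝒜 t ↔
      Dominated 𝒜 t (content 𝒜 f) (content 𝒜 g) := by
  rw [mem_kroneckerSet_iff hunit]
  refine ⟨?_, fun h => ⟨f, g, hg, rfl, h⟩⟩
  rintro ⟨f', g', hg', heq, hdom⟩
  have hK : ∀ g : R, g ≠ 0 → algebraMap R K g ≠ 0 := fun g hg => by simpa using hg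
  rw [div_eq_div_iff (hK g hg) (hK g' hg'), ← map_mul, ← map_mul] at heq
  have heq' := FaithfulSMul.algebraMap_injective R K heq
  refine Dominated.cancel_right (content_isHomogeneous 𝒜 g') (content_fg 𝒜 g')
    (content_ne_bot 𝒜 hg') ?_
  refine (dominated_content_mul 𝒜 t f g').trans ?_
  rw [heq', mul_comm (content 𝒜 g)]
  exact Dominated.trans (.of_le (content_mul_le 𝒜 _ _)) (hdom.mul_right _)

variable (𝒜 t) in
/-- The graded Kronecker function ring `Kr(R, ⋆)`, inside `K`. -/
def kroneckerRing (hunit : ∃ α : Γ, α ≠ 0 ∧ ∃ u ∈ 𝒜 α, IsUnit u) : Subalgebra R K where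
  carrier := kroneckerSet 𝒜 t
  mul_mem' := by
    rintro x y hx hy
    obtain ⟨f, g, hg, rfl, h⟩ := (mem_kroneckerSet_iff hunit).mp hx
    obtain ⟨f', g', hg', rfl, h'⟩ := (mem_kroneckerSet_iff hunit).mp hy
    rw [div_mul_div_comm, ← map_mul, ← map_mul,
      div_mem_kroneckerSet_iff hunit (mul_ne_zero hg hg')]
    exact Dominated.trans (.of_le (content_mul_le 𝒜 _ _))
      ((h.mul h').trans (dominated_content_mul 𝒜 t g g'))
  add_mem' := by
    rintro x y hx hy
    obtain ⟨f, g, hg, rfl, h⟩ := (mem_kroneckerSet_iff hunit).mp hx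
    obtain ⟨f', g', hg', rfl, h'⟩ := (mem_kroneckerSet_iff hunit).mp hy
    have hK : ∀ g : R, g ≠ 0 → algebraMap R K g ≠ 0 := fun g hg => by simpa using hg
    rw [div_add_div _ _ (hK g hg) (hK g' hg'), ← map_mul, ← map_mul, ← map_mul, ← map_add,
      div_mem_kroneckerSet_iff hunit (mul_ne_zero hg hg')]
    refine Dominated.trans (.of_le ((content_add_le 𝒜 _ _).trans
      (sup_le_sup (content_mul_le 𝒜 _ _) (content_mul_le 𝒜 _ _))))
      (Dominated.trans (.sup (h.mul_right _) ?_) (dominated_content_mul 𝒜 t g g'))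
    rw [mul_comm (content 𝒜 g), mul_comm (content 𝒜 g)]
    exact h'.mul_right _
  algebraMap_mem' r := (mem_kroneckerSet_iff hunit).mpr ⟨r, 1, one_ne_zero, by simp,
    .of_le (by rw [content_one]; exact le_top)⟩

theorem nagataRing_le_kroneckerRing (hunit : ∃ α : Γ, α ≠ 0 ∧ ∃ u ∈ 𝒜 α, IsUnit u) :
    nagataRing 𝒜 s ≤ kroneckerRing 𝒜 s.tilde hunit := by
  intro x hx
  obtain ⟨g, hg, a, h⟩ := mem_nagataRing.mp hx
  have hg0 : g ≠ 0 := nonZeroDivisors.ne_zero (nagataSet_le 𝒜 s hg)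
  have hgK : algebraMap R K g ≠ 0 := by simpa using hg0
  refine (mem_kroneckerSet_iff hunit).mpr ⟨a, g, hg0, eq_div_of_mul_eq hgK h,
    ⊤, Ideal.IsHomogeneous.top 𝒜, Ideal.fg_top R, top_ne_bot, ?_⟩
  rw [Ideal.mul_top, Ideal.mul_top, (isDense_content hg).tilde_eq]
  exact (SemistarOperation.coeSubmodule_le_one _).trans (s.tilde.le' 1)

theorem kroneckerRing_le_nagataRing (hunit : ∃ α : Γ, α ≠ 0 ∧ ∃ u ∈ 𝒜 α, IsUnit u)
    (hG : ∀ f : R, (content 𝒜 f).map (algebraMap R (nagataRing 𝒜 s)) =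
      Ideal.span {algebraMap R (nagataRing 𝒜 s) f}) :
    kroneckerRing 𝒜 s.tilde hunit ≤ nagataRing 𝒜 s := by
  rintro x ⟨f, g, hg, rfl, h, h0, hle⟩
  -- The domination gives fhz ∈ C(g)C(h) for some z ∈ N. In T the right side becomes ghT, so fz/g ∈
  -- T.
  obtain ⟨z, hz, hmem⟩ := exists_mul_mem_of_mem_tilde hunit
    (hle ⟨f * h, Ideal.mul_mem_mul (mem_content_self 𝒜 f) (mem_content_self 𝒜 h), rfl⟩)
  obtain ⟨c, hc, hc'⟩ := hmem
  rw [Algebra.linearMap_apply, Algebra.linearMap_apply, ← map_mul] at hc'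
  rw [FaithfulSMul.algebraMap_injective R K hc'] at hc
  have hmap := Ideal.mem_map_of_mem (algebraMap R (nagataRing 𝒜 s)) hc
  rw [Ideal.map_mul, hG, hG, Ideal.span_singleton_mul_span_singleton] at hmap
  obtain ⟨w, hw⟩ := Ideal.mem_span_singleton'.mp hmap
  have hwK : (w : K) * (algebraMap R K g * algebraMap R K h) =
      algebraMap R K f * algebraMap R K h * algebraMap R K z := by
    have := congrArg Subtype.val hw
    simpa [map_mul] using this
  obtain ⟨g', hg', a, ha⟩ := mem_nagataRing.mp w.2
  have hgK : algebraMap R K g ≠ 0 := by simpa using hg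
  have hhK : algebraMap R K h ≠ 0 := by simpa using h0
  refine mem_nagataRing.mpr ⟨z * g', mul_mem hz hg', a, ?_⟩
  rw [← ha, map_mul, ← mul_assoc]
  congr 1
  rw [div_mul_eq_mul_div, div_eq_iff hgK]
  exact mul_right_cancel₀ hhK (by linear_combination -hwK)

/-- From H ⊆ (C(d)H)^⋆̃ with H finitely generated, one dense J satisfies JH ⊆ C(d)H. The determinant
trick then puts a power of J inside C(d). -/
theorem mem_nagataSet_of_dominated {d : R} (h : Dominated 𝒜 s.tilde ⊤ (content 𝒜 d)) :
    d ∈ nagataSet 𝒜 s := by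
  obtain ⟨H, -, hfg, h0, hle⟩ := h
  obtain ⟨J, hJ, hJH⟩ := s.exists_uniform_isDense
    (IsLocalization.coeSubmodule K (content 𝒜 d * H)) 1 H hfg (fun y hy => by
      rw [one_mul]
      exact hle ⟨y, by rwa [Ideal.top_mul], rfl⟩)
  have hJH' : J * H ≤ content 𝒜 d * H := by
    rw [Ideal.mul_le]
    intro j hj y hy
    obtain ⟨c, hc, hc'⟩ := hJH y hy j hj
    rw [one_mul, Algebra.linearMap_apply, ← map_mul] at hc'
    rwa [mul_comm j, ← FaithfulSMul.algebraMap_injective R K hc']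
  obtain ⟨n, hn⟩ := Ideal.exists_pow_le_of_le_radical_of_fg
    (Ideal.le_radical_of_mul_le_mul hfg h0 hJH') hJ.1
  have hpow : ∀ n : ℕ, s.IsDense (J ^ n) := by
    intro n
    induction n with
    | zero => simpa using s.isDense_top
    | succ n ih => rw [pow_succ]; exact ih.mul hJ
  exact mem_nagataSet_of_le (hpow n) ((Submodule.map_mono hn).trans (s.le' _))

theorem isNagataInvertible_of_flat (hunit : ∃ α : Γ, α ≠ 0 ∧ ∃ u ∈ 𝒜 α, IsUnit u)
    (hflat : Module.Flat R (kroneckerRing 𝒜 s.tilde hunit)) {I : Ideal R}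
    (hI : I.IsHomogeneous 𝒜) (hfg : I.FG) (h0 : I ≠ ⊥) : IsNagataInvertible 𝒜 s I := by
  have hdiv : ∀ {c f : R}, f ≠ 0 → c ∈ content 𝒜 f →
      algebraMap R K c / algebraMap R K f ∈ kroneckerRing 𝒜 s.tilde hunit := fun hf hc =>
    (div_mem_kroneckerSet_iff hunit hf).mpr (.of_le (content_le_of_mem_content 𝒜 hc))
  have hmul : ∀ {c f : R} (hf : f ≠ 0) (hc : c ∈ content 𝒜 f),
      algebraMap R (kroneckerRing 𝒜 s.tilde hunit) f * ⟨_, hdiv hf hc⟩ =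
        algebraMap R (kroneckerRing 𝒜 s.tilde hunit) c := by
    intro c f hf hc
    have hfK : algebraMap R K f ≠ 0 := by simpa using hf
    exact Subtype.ext (mul_div_cancel₀ _ hfK)
  obtain ⟨f, rfl⟩ := exists_content_eq hunit hI hfg
  have hf : f ≠ 0 := by rintro rfl; simp at h0
  -- For c ∈ C(f), c/f ∈ Kr, so flatness makes (f : c) extend to Kr. The product of the colon ideals
  -- of two submodules lies in the colon of their sum, so the property passes to all of C(f).
  have hD : ∀ M : Ideal R, M.FG → M ≤ content 𝒜 f → ((Ideal.span {f}).colon (M : Set R)).map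
      (algebraMap R (kroneckerRing 𝒜 s.tilde hunit)) = ⊤ := by
    intro M hM hle
    induction M, hM using Submodule.fg_induction with
    | singleton c =>
      rw [Submodule.colon_span]
      exact Module.Flat.map_colon_singleton_eq_top
        (hmul hf (hle (Submodule.mem_span_singleton_self c)))
    | sup M₁ M₂ _ _ h₁ h₂ =>
      rw [eq_top_iff, ← Ideal.top_mul ⊤]
      nth_rw 1 [← h₁ (le_sup_left.trans hle), ← h₂ (le_sup_right.trans hle)]
      rw [← Ideal.map_mul]
      refine Ideal.map_mono fun d hd => Submodule.mem_colon.mpr fun v hv => ?_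
      obtain ⟨v₁, hv₁, v₂, hv₂, rfl⟩ := Submodule.mem_sup.mp hv
      rw [smul_add]
      exact add_mem (Submodule.mem_colon.mp (Ideal.mul_le_left hd) v₁ hv₁)
        (Submodule.mem_colon.mp (Ideal.mul_le_right hd) v₂ hv₂)
  obtain ⟨D₁, hD₁, hle, hD₁top⟩ := Ideal.exists_fg_le_map_eq_top (hD _ hfg le_rfl)
  obtain ⟨d, hd, hd'⟩ := exists_mem_le_content 𝒜 hunit hD₁
  have hd0 : d ≠ 0 := by
    rintro rfl
    rw [content_zero, le_bot_iff] at hd'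
    rw [hd', Ideal.map_bot] at hD₁top
    exact bot_ne_top hD₁top
  -- Since D₁ ⊆ C(d), every c ∈ D₁ is a multiple of d in Kr. So d is a unit there, 1/d ∈ Kr means R
  -- ≺ C(d), and d ∈ N.
  have hdN : d ∈ nagataSet 𝒜 s := by
    refine mem_nagataSet_of_dominated ?_
    rw [← content_one 𝒜, ← div_mem_kroneckerSet_iff hunit hd0]
    have hspan1 : Ideal.span {algebraMap R (kroneckerRing 𝒜 s.tilde hunit) d} = ⊤ := by
      rw [eq_top_iff, ← hD₁top, Ideal.map_le_iff_le_comap]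
      intro c hc
      rw [Ideal.mem_comap, ← hmul hd0 (hd' hc)]
      exact Ideal.mul_mem_right _ _ (Ideal.mem_span_singleton_self _)
    obtain ⟨w, hw⟩ := Ideal.mem_span_singleton'.mp ((Ideal.eq_top_iff_one _).mp hspan1)
    have hwK : (w : K) * algebraMap R K d = 1 := congrArg Subtype.val hw
    have hdK : algebraMap R K d ≠ 0 := by simpa using hd0
    rw [map_one, ← eq_div_of_mul_eq hdK hwK]
    exact w.2
  refine ⟨f, hf, (Ideal.span {f}).colon (content 𝒜 f : Set R), d, hdN, ?_,
    Ideal.mul_mem_mul (mem_content_self 𝒜 f) (hle hd)⟩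
  rw [mul_comm, Ideal.mul_le]
  exact fun b hb v hv => Submodule.mem_colon.mp hb v hv

end GradedDomain

/-! ### Integral closedness of R_H. -/

/-- The homogenized equation is used because it survives ring homomorphisms that are not defined on
the fraction F/G. -/
theorem IsIntegrallyClosed.dvd_of_sum_eq_zero {B : Type*} [CommRing B] [IsDomain B]
    [IsIntegrallyClosed B] (L : Type*) [Field L] [Algebra B L] [IsFractionRing B L] {F G : B}
    (hG : G ≠ 0) {d : ℕ} (P : ℕ → B) (hP : P d = 1)
    (h : ∑ i ∈ Finset.range (d + 1), P i * F ^ i * G ^ (d - i) = 0) : G ∣ F := by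
  have hGL : algebraMap B L G ≠ 0 := by simpa using hG
  have hint : IsIntegral B (algebraMap B L F / algebraMap B L G) := by
    refine ⟨Polynomial.X ^ d + ∑ i : Fin d, Polynomial.C (P i) * Polynomial.X ^ (i : ℕ),
      Polynomial.monic_X_pow_add (Polynomial.degree_sum_fin_lt _), ?_⟩
    have h' := congrArg (algebraMap B L) h
    rw [map_sum, map_zero, Finset.sum_range_succ, ← Fin.sum_univ_eq_sum_range
      (fun i => algebraMap B L (P i * F ^ i * G ^ (d - i)))] at h'
    refine mul_right_cancel₀ (pow_ne_zero d hGL) ?_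
    rw [zero_mul, ← h', ← Polynomial.aeval_def]
    simp only [map_add, map_pow, Polynomial.aeval_X, map_sum, map_mul, Polynomial.aeval_C,
      add_mul, Finset.sum_mul, hP, Nat.sub_self, pow_zero, mul_one, one_mul]
    rw [add_comm]
    congr 1
    · refine Finset.sum_congr rfl fun i _ => ?_
      have hpow : algebraMap B L G ^ d =
          algebraMap B L G ^ (d - (i : ℕ)) * algebraMap B L G ^ (i : ℕ) := by
        rw [← pow_add, Nat.sub_add_cancel i.2.le]
      rw [div_pow, hpow]
      field_simp
    · rw [div_pow, div_mul_cancel₀ _ (pow_ne_zero d hGL)]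
  obtain ⟨q, hq⟩ := IsIntegrallyClosed.isIntegral_iff.mp hint
  refine ⟨q, IsFractionRing.injective B L ?_⟩
  rw [map_mul, hq, mul_div_cancel₀ _ hGL]

open LaurentPolynomial in
theorem LaurentPolynomial.isIntegrallyClosed (K : Type*) [Field K] : IsIntegrallyClosed K[T;T⁻¹] :=
  isIntegrallyClosed_of_isLocalization _ (Submonoid.powers (Polynomial.X : Polynomial K))
    (powers_le_nonZeroDivisors_of_noZeroDivisors Polynomial.X_ne_zero)

namespace AddMonoidAlgebra

theorem mem_range_mapRingHom_subtype {K G : Type*} [CommRing K] [AddMonoid G] {A : Subring K}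
    {x : AddMonoidAlgebra K G} :
    x ∈ (mapRingHom G A.subtype).range ↔ ∀ i, x.coeff i ∈ A := by
  have := Set.ext_iff.mp (AddMonoidAlgebra.range_map (M := G) A.subtype.toAddMonoidHom) x
  refine Iff.trans ?_ (this.trans ?_)
  · exact Iff.rfl
  · refine forall_congr' fun i => ?_
    change x.coeff i ∈ Set.range A.subtype ↔ _
    rw [Subring.coe_subtype, Subtype.range_coe]
    rfl

/-- A coefficient of qu at a unique sum is a single product, so dividing by the invertible
coefficient of u puts one coefficient of q in A. Subtract that term and repeat. -/
theorem coeff_mem_of_coeff_mul_mem {K G : Type*} [Field K] [AddMonoid G] [UniqueSums G]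
    {A : Subring K} {u q : AddMonoidAlgebra K G} (hu0 : u ≠ 0)
    (hu : ∀ i, u.coeff i ∈ A ∧ (u.coeff i)⁻¹ ∈ A) (h : ∀ i, (q * u).coeff i ∈ A) (i : G) :
    q.coeff i ∈ A := by
  classical
  induction hn : q.coeff.support.card using Nat.strong_induction_on generalizing q i with
  | _ n ih =>
  subst hn
  rcases eq_or_ne q 0 with rfl | hq
  · exact zero_mem A
  have key : ∀ v : AddMonoidAlgebra K G, v ≠ 0 → v.coeff.support.Nonempty := by
    intro v hv
    rw [Finset.nonempty_iff_ne_empty, Ne, Finsupp.support_eq_empty]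
    exact fun h => hv (by ext; simp [h])
  obtain ⟨k, hk, j, hj, huniq⟩ := UniqueSums.uniqueAdd_of_nonempty (key q hq) (key u hu0)
  have hkA : q.coeff k ∈ A := by
    have h1 := h (k + j)
    rw [coeff_mul_add_of_uniqueAdd huniq] at h1
    have h2 := mul_mem h1 (hu j).2
    rwa [mul_inv_cancel_right₀ (Finsupp.mem_support_iff.mp hj)] at h2
  have hsingle : ∀ l, (single k (q.coeff k)).coeff l ∈ A := by
    intro l
    rw [coeff_single, Finsupp.single_apply]
    split_ifs
    · exact hkA
    · exact zero_mem A
  have hlt : (q - single k (q.coeff k)).coeff.support.card < q.coeff.support.card := by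
    refine Finset.card_lt_card ⟨fun l hl => ?_, fun hsub => ?_⟩
    · rw [Finsupp.mem_support_iff, coeff_sub, Finsupp.sub_apply, coeff_single,
        Finsupp.single_apply] at hl
      rw [Finsupp.mem_support_iff]
      intro hl0
      rcases eq_or_ne k l with rfl | hne
      · simp at hl
      · simp [hl0, hne] at hl
    · have := hsub hk
      rw [Finsupp.mem_support_iff, coeff_sub, Finsupp.sub_apply, coeff_single,
        Finsupp.single_apply] at this
      simp at this
  have hrec := ih _ hlt (q := q - single k (q.coeff k)) (by
    rw [← mem_range_mapRingHom_subtype] at h hsingle ⊢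
    rw [sub_mul]
    exact sub_mem h (mul_mem hsingle (mem_range_mapRingHom_subtype.mpr fun l => (hu l).1))) i rfl
  rw [coeff_sub, Finsupp.sub_apply] at hrec
  have := add_mem hrec (hsingle i)
  rwa [sub_add_cancel] at this

theorem coeff_mapDomain_mem {K G G' : Type*} [CommRing K] [AddMonoid G] [AddMonoid G']
    {A : Subring K} (φ : G →+ G') {x : AddMonoidAlgebra K G} (hx : ∀ i, x.coeff i ∈ A) (i : G') :
    (mapDomain φ x).coeff i ∈ A := by
  classical
  rw [mapDomain, coeff_ofCoeff, Finsupp.mapDomain, Finsupp.sum_apply]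
  refine sum_mem fun j _ => ?_
  beta_reduce
  rw [Finsupp.single_apply]
  split_ifs
  · exact hx j
  · exact zero_mem A

end AddMonoidAlgebra

/-- A finitely generated M embeds in some ℤⁿ, read here as integer polynomials of degree below n.
Evaluation at an integer is injective on a finite set once it avoids the roots of all differences.
-/
theorem exists_addMonoidHom_int_injective_on {Γ : Type*} [AddCancelCommMonoid Γ]
    [IsAddTorsionFree Γ] (S : Finset Γ) :
    ∃ φ : AddSubmonoid.closure (S : Set Γ) →+ ℤ, ∀ a b : AddSubmonoid.closure (S : Set Γ),
      a.1 ∈ S → b.1 ∈ S → φ a = φ b → a = b := by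
  classical
  let M := AddSubmonoid.closure (S : Set Γ)
  have : AddMonoid.FG M := (AddMonoid.fg_iff_addSubmonoid_fg M).mpr ⟨S, rfl⟩
  have : IsAddTorsionFree M := Subtype.val_injective.isAddTorsionFree M.subtype
  let _ : AddCancelCommMonoid M :=
    { (inferInstance : AddCommMonoid M) with
      add_left_cancel := fun a b c h =>
        Subtype.ext (add_left_cancel (congrArg Subtype.val h)) }
  let n := AffineAddMonoid.dim M
  let ρ : M →+ Polynomial ℤ :=
    ((Polynomial.degreeLT ℤ n).subtype.toAddMonoidHom.comp
      (((Polynomial.degreeLTEquiv ℤ n).symm.toLinearMap.toAddMonoidHom.comp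
        Finsupp.coeFnAddHom).comp (FreeAbelianGroup.equivFinsupp (Fin n)).toAddMonoidHom)).comp
      (AffineAddMonoid.embedding M)
  have hρ : Function.Injective ρ := by
    intro a b h
    exact AffineAddMonoid.embedding_injective ((FreeAbelianGroup.equivFinsupp (Fin n)).injective
      (DFunLike.coe_injective ((Polynomial.degreeLTEquiv ℤ n).symm.injective
        (Subtype.val_injective h))))
  let T : Finset M := S.subtype (· ∈ M)
  let P : Polynomial ℤ := ∏ p ∈ (T ×ˢ T).filter (fun p => p.1 ≠ p.2), (ρ p.1 - ρ p.2)
  have hP : P ≠ 0 := by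
    refine Finset.prod_ne_zero_iff.mpr fun p hp => ?_
    rw [sub_ne_zero]
    exact fun h => (Finset.mem_filter.mp hp).2 (hρ h)
  obtain ⟨c, hc⟩ : ∃ c : ℤ, P.eval c ≠ 0 := by
    by_contra hcon
    push Not at hcon
    exact hP (Polynomial.funext (by simpa using hcon))
  refine ⟨(Polynomial.evalRingHom c).toAddMonoidHom.comp ρ, fun a b ha hb hab => ?_⟩
  by_contra hne
  refine hc ?_
  rw [Polynomial.eval_prod]
  refine Finset.prod_eq_zero (i := (a, b)) (by simp [T, ha, hb, hne]) ?_
  rw [Polynomial.eval_sub, sub_eq_zero]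
  exact hab

namespace GradedDomain

variable {Γ R : Type*} [AddCancelCommMonoid Γ] [DecidableEq Γ] [CommRing R]
variable (𝒜 : Γ → AddSubgroup R) [GradedRing 𝒜] (K : Type*) [Field K] [Algebra R K]

/-- The ring homomorphism `a ↦ ∑ a_γ X^γ` from a graded ring to the monoid algebra. -/
noncomputable def coaction : R →+* AddMonoidAlgebra K Γ :=
  (DirectSum.toSemiring (fun i => (AddMonoidAlgebra.singleAddHom (R := K) i).comp
    ((algebraMap R K).toAddMonoidHom.comp (𝒜 i).subtype))
    (by
      change AddMonoidAlgebra.single 0 (algebraMap R K 1) = 1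
      rw [map_one]
      rfl)
    (by
      intro i j a b
      change AddMonoidAlgebra.single (i + j) (algebraMap R K (a * b)) =
        AddMonoidAlgebra.single i (algebraMap R K a) * AddMonoidAlgebra.single j (algebraMap R K b)
      rw [AddMonoidAlgebra.single_mul_single, map_mul])).comp
    (DirectSum.decomposeRingEquiv 𝒜).toRingHom

theorem coaction_of_mem {i : Γ} {a : R} (ha : a ∈ 𝒜 i) :
    coaction 𝒜 K a = AddMonoidAlgebra.single i (algebraMap R K a) := by
  have h : (DirectSum.decomposeRingEquiv 𝒜).toRingHom a = DirectSum.of _ i ⟨a, ha⟩ :=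
    DirectSum.decompose_of_mem 𝒜 ha
  rw [coaction, RingHom.comp_apply, h, DirectSum.toSemiring_of]
  rfl

theorem coeff_coaction (a : R) (γ : Γ) :
    (coaction 𝒜 K a).coeff γ = algebraMap R K (DirectSum.decompose 𝒜 a γ) := by
  classical
  induction a using DirectSum.Decomposition.inductionOn 𝒜 with
  | zero => simp
  | @homogeneous i m =>
    rw [coaction_of_mem 𝒜 K m.2, AddMonoidAlgebra.coeff_single, Finsupp.single_apply]
    split_ifs with h
    · subst h
      rw [DirectSum.decompose_of_mem_same 𝒜 m.2]
    · rw [DirectSum.decompose_of_mem_ne 𝒜 m.2 h, map_zero]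
  | add a b ha hb =>
    rw [map_add, AddMonoidAlgebra.coeff_add, Finsupp.add_apply, ha, hb, DirectSum.decompose_add,
      DirectSum.add_apply, AddSubgroup.coe_add, map_add]

/-- Setting X = 1 recovers a from ∑ a_γ X^γ, which carries the quotient found among Laurent
polynomials back to K. -/
theorem lift_one_coaction (a : R) :
    AddMonoidAlgebra.lift K K Γ 1 (coaction 𝒜 K a) = algebraMap R K a := by
  induction a using DirectSum.Decomposition.inductionOn 𝒜 with
  | zero => simp
  | @homogeneous i m =>
    rw [coaction_of_mem 𝒜 K m.2, AddMonoidAlgebra.lift_single]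
    simp
  | add a b ha hb => rw [map_add, map_add, map_add, ha, hb]

variable {K} [IsDomain R] [IsFractionRing R K] [IsAddTorsionFree Γ]

/-- The homogeneous quotient field is integrally closed. -/
theorem mem_homogeneousQuotientField_of_isIntegral {x : K} (hx : IsIntegral R x) :
    x ∈ homogeneousQuotientField 𝒜 K := by
  classical
  obtain ⟨f, g, hg, rfl⟩ := IsFractionRing.div_surjective R x
  have hg0 : g ≠ 0 := nonZeroDivisors.ne_zero hg
  have hgK : algebraMap R K g ≠ 0 := by simpa using hg0
  obtain ⟨p, hp, hpx⟩ := hx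
  have hsum : ∑ i ∈ Finset.range (p.natDegree + 1),
      p.coeff i * f ^ i * g ^ (p.natDegree - i) = 0 := by
    refine FaithfulSMul.algebraMap_injective R K ?_
    rw [← Polynomial.aeval_def, Polynomial.aeval_eq_sum_range] at hpx
    have := congrArg (· * algebraMap R K g ^ p.natDegree) hpx
    simp only [Finset.sum_mul, zero_mul] at this
    rw [map_sum, map_zero, ← this]
    refine Finset.sum_congr rfl fun i hi => ?_
    have hi' : i ≤ p.natDegree := Nat.lt_succ_iff.mp (Finset.mem_range.mp hi)
    rw [map_mul, map_mul, map_pow, map_pow, Algebra.smul_def, div_pow, mul_assoc, mul_assoc,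
      div_mul_eq_mul_div]
    nth_rw 2 [← Nat.sub_add_cancel hi']
    rw [pow_add, ← mul_assoc (algebraMap R K f ^ i), mul_div_cancel_right₀ _ (pow_ne_zero i hgK)]
  let deg : R → Finset Γ := fun a => (finite_components (𝒜 := 𝒜) a).toFinset
  -- All degrees occurring in the integral equation. They generate a finitely generated monoid M,
  -- and φ specializes the grading to ℤ without merging degrees in S.
  let S : Finset Γ := deg f ∪ deg g ∪ (Finset.range (p.natDegree + 1)).biUnion
    fun i => deg (p.coeff i)
  let M := AddSubmonoid.closure (S : Set Γ)
  obtain ⟨φ, hφ⟩ : ∃ φ : M →+ ℤ, ∀ a b : M, a.1 ∈ S → b.1 ∈ S → φ a = φ b → a = b :=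
    exists_addMonoidHom_int_injective_on S
  let res : R → AddMonoidAlgebra K M := fun a =>
    AddMonoidAlgebra.comapDomain M.subtype Subtype.val_injective (coaction 𝒜 K a)
  let ι : AddMonoidAlgebra K M →+* AddMonoidAlgebra K Γ :=
    AddMonoidAlgebra.mapDomainRingHom K M.subtype
  let Φ : AddMonoidAlgebra K M →+* AddMonoidAlgebra K ℤ := AddMonoidAlgebra.mapDomainRingHom K φ
  have hι : Function.Injective ι := AddMonoidAlgebra.mapDomain_injective Subtype.val_injective
  have hres : ∀ a, deg a ⊆ S → ι (res a) = coaction 𝒜 K a := by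
    intro a ha
    refine AddMonoidAlgebra.mapDomain_comapDomain (fun γ hγ => ?_) Subtype.val_injective
    have : γ ∈ S := by
      refine ha ?_
      rw [Set.Finite.mem_toFinset]
      intro h0
      rw [Finset.mem_coe, Finsupp.mem_support_iff, coeff_coaction, h0] at hγ
      simp at hγ
    exact ⟨⟨γ, AddSubmonoid.subset_closure this⟩, rfl⟩
  have hfS : deg f ⊆ S := fun γ h => by simp [S, h]
  have hgS : deg g ⊆ S := fun γ h => by simp [S, h]
  have hpS : ∀ i ∈ Finset.range (p.natDegree + 1), deg (p.coeff i) ⊆ S := fun i hi =>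
    (Finset.subset_biUnion_of_mem (fun i => deg (p.coeff i)) hi).trans Finset.subset_union_right
  have hrescoeff : ∀ a (m : M), (res a).coeff m = algebraMap R K (DirectSum.decompose 𝒜 a m) := by
    intro a m
    rw [← coeff_coaction]
    rfl
  have hε : ∀ z : AddMonoidAlgebra K M,
      AddMonoidAlgebra.lift K K ℤ 1 (Φ z) = AddMonoidAlgebra.lift K K Γ 1 (ι z) := by
    intro z
    induction z using AddMonoidAlgebra.induction_linear with
    | zero => simp
    | add x y hx hy => rw [map_add, map_add, map_add, map_add, hx, hy]
    | single m r =>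
      have h₁ : Φ (.single m r) = .single (φ m) r := AddMonoidAlgebra.mapDomain_single
      have h₂ : ι (.single m r) = .single (m : Γ) r := AddMonoidAlgebra.mapDomain_single
      rw [h₁, h₂, AddMonoidAlgebra.lift_single, AddMonoidAlgebra.lift_single]
      rfl
  have hεres : ∀ a, deg a ⊆ S →
      AddMonoidAlgebra.lift K K ℤ 1 (Φ (res a)) = algebraMap R K a := by
    intro a ha
    rw [hε, hres a ha, lift_one_coaction]
  have hG0 : Φ (res g) ≠ 0 := by
    intro h0
    have := hεres g hgS
    rw [h0, map_zero] at this
    exact hgK this.symm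
  have hsumΦ : ∑ i ∈ Finset.range (p.natDegree + 1),
      Φ (res (p.coeff i)) * Φ (res f) ^ i * Φ (res g) ^ (p.natDegree - i) = 0 := by
    have : ∑ i ∈ Finset.range (p.natDegree + 1),
        res (p.coeff i) * res f ^ i * res g ^ (p.natDegree - i) = 0 := by
      refine hι ?_
      rw [map_sum, map_zero, ← map_zero (coaction 𝒜 K), ← hsum, map_sum]
      refine Finset.sum_congr rfl fun i hi => ?_
      rw [map_mul, map_mul, map_pow, map_pow, hres _ (hpS i hi), hres _ hfS, hres _ hgS, map_mul,
        map_mul, map_pow, map_pow]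
    have := congrArg Φ this
    rw [map_sum, map_zero] at this
    rw [← this]
    refine Finset.sum_congr rfl fun i _ => ?_
    rw [map_mul, map_mul, map_pow, map_pow]
  have hlead : Φ (res (p.coeff p.natDegree)) = 1 := by
    have : res (p.coeff p.natDegree) = 1 := by
      refine hι ?_
      rw [hres _ (hpS _ (Finset.self_mem_range_succ _)), hp.coeff_natDegree, map_one, map_one]
    rw [this, map_one]
  have hIC : IsIntegrallyClosed (AddMonoidAlgebra K ℤ) := LaurentPolynomial.isIntegrallyClosed K
  obtain ⟨q, hq⟩ := IsIntegrallyClosed.dvd_of_sum_eq_zero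
    (FractionRing (AddMonoidAlgebra K ℤ)) hG0
    (fun i => Φ (res (p.coeff i))) hlead hsumΦ
  set A := (homogeneousQuotientField 𝒜 K).toSubring
  have hRA : ∀ a : R, algebraMap R K a ∈ A := fun a => Subalgebra.algebraMap_mem _ a
  have hqA : ∀ k, q.coeff k ∈ A := by
    -- As φ is injective on S, each nonzero coefficient of the image of g is a single homogeneous
    -- component of g, hence invertible in R_H.
    refine AddMonoidAlgebra.coeff_mem_of_coeff_mul_mem hG0 (fun k => ?_) (fun k => ?_)
    · have hGA : ∀ k, (Φ (res g)).coeff k ∈ A :=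
        AddMonoidAlgebra.coeff_mapDomain_mem φ fun m => by rw [hrescoeff]; exact hRA _
      refine ⟨hGA k, ?_⟩
      by_cases h0 : (Φ (res g)).coeff k = 0
      · rw [h0, inv_zero]; exact zero_mem A
      have hmem : k ∈ Finset.image φ (res g).coeff.support :=
        Finsupp.mapDomain_support (Finsupp.mem_support_iff.mpr h0)
      obtain ⟨m, hm, rfl⟩ := Finset.mem_image.mp hmem
      have hsupp : ∀ m ∈ (res g).coeff.support, (m : Γ) ∈ S := by
        intro m hm
        refine hgS ?_
        rw [Set.Finite.mem_toFinset]
        intro h0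
        rw [Finsupp.mem_support_iff, hrescoeff, h0] at hm
        simp at hm
      have hval : (Φ (res g)).coeff (φ m) = (res g).coeff m :=
        Finsupp.mapDomain_apply' ((res g).coeff.support : Set M) _ subset_rfl
          (fun a ha b hb hab => hφ a b (hsupp a ha) (hsupp b hb) hab) hm
      rw [hval, hrescoeff] at h0 ⊢
      refine mem_homogeneousQuotientField.mpr ⟨DirectSum.decompose 𝒜 g m,
        ⟨_, SetLike.coe_mem _⟩, fun h => h0 (by rw [h, map_zero]), 1, ?_⟩
      rw [inv_mul_cancel₀ h0, map_one]
    · rw [mul_comm, ← hq]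
      exact AddMonoidAlgebra.coeff_mapDomain_mem φ (fun m => by rw [hrescoeff]; exact hRA _) k
  have hεq : AddMonoidAlgebra.lift K K ℤ 1 q ∈ A := by
    rw [AddMonoidAlgebra.lift_apply]
    refine sum_mem fun k _ => ?_
    simpa using hqA k
  have hfin := congrArg (AddMonoidAlgebra.lift K K ℤ 1) hq
  rw [map_mul, hεres f hfS, hεres g hgS] at hfin
  rw [hfin, mul_div_cancel_left₀ _ hgK]
  exact hεq

end GradedDomain

/-! ### Integrality, ⋆̃ and the operation ⋆̃_a. -/

namespace SemistarOperation

variable {R K : Type*} [CommRing R] [Field K] [Algebra R K]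

theorem mul_mem_of_forall_mul_mem (s : SemistarOperation R K) {E F : Submodule R K} {q : K}
    (h : ∀ y ∈ E, q * y ∈ s F) {z : K} (hz : z ∈ s E) : q * z ∈ s F := by
  rcases eq_or_ne q 0 with rfl | hq
  · simp
  have hle : q • E ≤ s F := by
    rintro _ ⟨y, hy, rfl⟩
    exact h y hy
  have := s.mono' _ _ hle
  rw [s.idem', s.smul' q hq] at this
  exact this (Submodule.smul_mem_pointwise_smul _ q _ hz)

theorem mem_eab_of_forall_mul_mem (s : SemistarOperation R K) {E G : Submodule R K} (hE : E.FG)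
    (hE0 : E ≠ ⊥) (hG : G.FG) (hG0 : G ≠ ⊥) {x : K} (h : ∀ y ∈ G, x * y ∈ s (E * G)) :
    x ∈ s.eab E := by
  have hle : s (E * G) / s G ≤ s.eab E :=
    le_iSup_of_le ⟨E, hE, hE0, le_rfl⟩
      (le_iSup (fun G : {G : Submodule R K // G.FG ∧ G ≠ ⊥} => s (E * G.1) / s G.1) ⟨G, hG, hG0⟩)
  refine hle (Submodule.mem_div_iff_forall_mul_mem.mpr fun y hy => ?_)
  exact s.mul_mem_of_forall_mul_mem h hy

theorem le_eab (s : SemistarOperation R K) {E : Submodule R K} (hE : E.FG) (hE0 : E ≠ ⊥) :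
    s E ≤ s.eab E := by
  intro x hx
  refine s.mem_eab_of_forall_mul_mem hE hE0 (G := 1) ⟨{1}, by simp [Submodule.one_eq_span]⟩ ?_
    fun y hy => ?_
  · intro h
    have : (1 : K) ∈ (1 : Submodule R K) := Submodule.one_le.mp le_rfl
    rw [h] at this
    simp at this
  · obtain ⟨r, rfl⟩ := Submodule.mem_one.mp hy
    rw [mul_one, mul_comm, ← Algebra.smul_def]
    exact (s E).smul_mem r hx

variable [FaithfulSMul R K]

theorem exists_isDense_forall_mul_mem (s : SemistarOperation R K) {E F : Submodule R K}
    (hF : F.FG) (h : F ≤ s.tilde E) :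
    ∃ J : Ideal R, s.IsDense J ∧ ∀ y ∈ F, ∀ z ∈ J, y * algebraMap R K z ∈ E := by
  induction F, hF using Submodule.fg_induction with
  | singleton a =>
    obtain ⟨I, hI, hz⟩ := h (Submodule.mem_span_singleton_self a)
    refine ⟨I, hI, fun y hy z hzI => ?_⟩
    obtain ⟨r, rfl⟩ := Submodule.mem_span_singleton.mp hy
    rw [smul_mul_assoc]
    exact E.smul_mem r (hz z hzI)
  | sup F₁ F₂ _ _ h₁ h₂ =>
    obtain ⟨I₁, hI₁, hz₁⟩ := h₁ (le_sup_left.trans h)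
    obtain ⟨I₂, hI₂, hz₂⟩ := h₂ (le_sup_right.trans h)
    refine ⟨I₁ * I₂, hI₁.mul hI₂, fun y hy z hz => ?_⟩
    obtain ⟨a, ha, b, hb, rfl⟩ := Submodule.mem_sup.mp hy
    rw [add_mul]
    exact add_mem (hz₁ a ha z (Ideal.mul_le_left hz)) (hz₂ b hb z (Ideal.mul_le_right hz))

/-- If the elements of `K` integral over `R` lie in `R^⋆̃`, then so do those that multiply a
nonzero finitely generated module `G` into `G^⋆̃`. -/
theorem mem_tilde_one_of_forall_mul_mem (s : SemistarOperation R K)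
    (hint : ∀ x : K, IsIntegral R x → x ∈ s.tilde 1) {G : Submodule R K} (hG : G.FG)
    (hG0 : G ≠ ⊥) {w : K} (h : ∀ y ∈ G, w * y ∈ s.tilde G) : w ∈ s.tilde 1 := by
  have hle : G.map (LinearMap.mulLeft R w) ≤ s.tilde G := by
    rintro _ ⟨y, hy, rfl⟩
    exact h y hy
  -- One dense J serves all of wG, so wjG ⊆ G for every j ∈ J. Each wj is then integral over R, and
  -- wJ ⊆ R^⋆̃ gives w ∈ R^⋆̃.
  obtain ⟨J, hJ, hwJ⟩ := s.exists_isDense_forall_mul_mem (hG.map _) hle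
  rw [← s.tilde.idem']
  refine ⟨J, hJ, fun j hj => hint _ ?_⟩
  refine isIntegral_of_smul_mem_submodule (M := K) G hG0 hG _ fun y hy => ?_
  have := hwJ _ ⟨y, hy, rfl⟩ j hj
  rw [LinearMap.mulLeft_apply] at this
  rw [smul_eq_mul]
  convert this using 1
  ring

end SemistarOperation

namespace GradedDomain

variable {Γ R K : Type*} [AddCancelCommMonoid Γ] [DecidableEq Γ] [CommRing R]
variable {𝒜 : Γ → AddSubgroup R} [GradedRing 𝒜] [Field K] [Algebra R K]
variable [IsDomain R] [IsFractionRing R K] [IsAddTorsionFree Γ] {s : SemistarOperation R K}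

theorem coeSubmodule_fg_of_fg {I : Ideal R} (h : I.FG) : (IsLocalization.coeSubmodule K I).FG :=
  (IsLocalization.coeSubmodule_fg K (FaithfulSMul.algebraMap_injective R K) I).mpr h

theorem coeSubmodule_ne_bot {I : Ideal R} (h : I ≠ ⊥) : IsLocalization.coeSubmodule K I ≠ ⊥ := by
  rw [← IsLocalization.coeSubmodule_bot (R := R)]
  exact (IsFractionRing.coeSubmodule_injective R K).ne h

theorem mem_homogeneousQuotientField_of_isIntegral_self {x : K}
    (hx : IsIntegral (homogeneousQuotientField 𝒜 K) x) : x ∈ homogeneousQuotientField 𝒜 K := by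
  have : IsLocalization (homogeneousElements 𝒜) (homogeneousQuotientField 𝒜 K) :=
    Localization.subalgebra.isLocalization_ofField K _ (homogeneousElements_le 𝒜)
  obtain ⟨m, hm⟩ := hx.exists_multiple_integral_of_isLocalization (homogeneousElements 𝒜) x
  obtain ⟨h, hh, h0, a, ha⟩ := mem_homogeneousQuotientField.mp
    (mem_homogeneousQuotientField_of_isIntegral 𝒜 hm)
  refine mem_homogeneousQuotientField.mpr ⟨m * h, m.2.1.mul hh, mul_ne_zero m.2.2 h0, a, ?_⟩
  rw [← ha, Submonoid.smul_def, Algebra.smul_def, map_mul]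
  ring

theorem mem_nagataRing_of_isIntegral (hT : IsBezout (nagataRing 𝒜 s)) {x : K}
    (hx : IsIntegral (nagataRing 𝒜 s) x) : x ∈ nagataRing 𝒜 s := by
  have : IsGCDMonoid (nagataRing 𝒜 s) := inferInstance
  obtain ⟨y, rfl⟩ := IsIntegrallyClosed.isIntegral_iff.mp hx
  exact y.2

theorem isIntegral_of_subalgebra_le {A B : Subalgebra R K} (h : A ≤ B) {x : K}
    (hx : IsIntegral A x) : IsIntegral B x := by
  obtain ⟨p, hp, hpx⟩ := hx
  refine ⟨p.map (Subalgebra.inclusion h).toRingHom, hp.map _, ?_⟩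
  rw [Polynomial.eval₂_map]
  exact hpx

/-- As R^⋆ ⊆ R_H, the ring R^⋆̃ equals T ∩ R_H, an intersection of two integrally closed rings. -/
theorem isIntegrallyClosed_tilde_ring (hunit : ∃ α : Γ, α ≠ 0 ∧ ∃ u ∈ 𝒜 α, IsUnit u)
    (hs : s.ring ≤ homogeneousQuotientField 𝒜 K) (hT : IsBezout (nagataRing 𝒜 s)) :
    IsIntegrallyClosed s.tilde.ring := by
  rw [isIntegrallyClosed_iff K]
  intro x hx
  have h₁ : s.tilde.ring ≤ nagataRing 𝒜 s := fun y hy => tilde_one_le_nagataRing hunit hy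
  have h₂ : s.tilde.ring ≤ homogeneousQuotientField 𝒜 K := fun y hy => hs (s.tilde_le 1 hy)
  have hx' : x ∈ s.tilde 1 := mem_tilde_one_of_mem
    (mem_nagataRing_of_isIntegral hT (isIntegral_of_subalgebra_le h₁ hx))
    (mem_homogeneousQuotientField_of_isIntegral_self (isIntegral_of_subalgebra_le h₂ hx))
  exact ⟨⟨x, hx'⟩, rfl⟩

theorem tilde_eq_eab (hunit : ∃ α : Γ, α ≠ 0 ∧ ∃ u ∈ 𝒜 α, IsUnit u)
    (hT : IsBezout (nagataRing 𝒜 s)) {I : Ideal R} (hI : I.IsHomogeneous 𝒜) (hfg : I.FG)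
    (h0 : I ≠ ⊥) (hinv : IsNagataInvertible 𝒜 s I) :
    s.tilde (IsLocalization.coeSubmodule K I) = s.tilde.eab (IsLocalization.coeSubmodule K I) := by
  have hint : ∀ x : K, IsIntegral R x → x ∈ s.tilde 1 := fun x hx =>
    mem_tilde_one_of_mem (mem_nagataRing_of_isIntegral hT hx.tower_top)
      (mem_homogeneousQuotientField_of_isIntegral 𝒜 hx)
  refine le_antisymm (s.tilde.le_eab (coeSubmodule_fg_of_fg hfg) (coeSubmodule_ne_bot h0)) ?_
  refine iSup_le fun F => iSup_le fun G x hx => ?_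
  rw [Submodule.mem_div_iff_forall_mul_mem] at hx
  have hxG : ∀ y ∈ G.1, x * y ∈ s.tilde (IsLocalization.coeSubmodule K I * G.1) := fun y hy =>
    s.tilde.mono' _ _ (mul_le_mul_left F.2.2.2 _) (hx y (s.tilde.le' _ hy))
  obtain ⟨a, -, ha, y₀, r, hr, hle, hge⟩ := hinv.exists_content hunit hI h0
  have haK : algebraMap R K a ≠ 0 := by simpa using ha
  -- Since b/a maps I into R, the element (b/a)x maps G into G^⋆̃ and is caught by the determinant
  -- trick.
  have hw : ∀ b ∈ content 𝒜 y₀, algebraMap R K b / algebraMap R K a * x ∈ s.tilde 1 := by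
    intro b hb
    refine s.mem_tilde_one_of_forall_mul_mem hint G.2.1 G.2.2 fun y hy => ?_
    rw [mul_assoc]
    refine s.tilde.mul_mem_of_forall_mul_mem (fun z hz => ?_) (hxG y hy)
    refine s.tilde.le' _ ?_
    induction hz using Submodule.mul_induction_on' with
    | mem_mul_mem i hi g hg =>
      obtain ⟨i, hi, rfl⟩ := hi
      obtain ⟨d, hd⟩ := Ideal.mem_span_singleton'.mp (hle (Ideal.mul_mem_mul hi hb))
      have : algebraMap R K b / algebraMap R K a * (Algebra.linearMap R K i * g) = d • g := by
        rw [Algebra.linearMap_apply, Algebra.smul_def, ← mul_assoc, div_mul_eq_mul_div, ← map_mul,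
          mul_comm b, ← hd, map_mul, mul_div_cancel_right₀ _ haK]
      rw [this]
      exact G.1.smul_mem d hg
    | add p _ q _ hp hq =>
      rw [mul_add]
      exact add_mem hp hq
  have hu : ∀ u ∈ I * content 𝒜 y₀, algebraMap R K u / algebraMap R K a * x ∈
      s.tilde (IsLocalization.coeSubmodule K I) := by
    intro u hu
    induction hu using Submodule.mul_induction_on' with
    | mem_mul_mem i hi b hb =>
      rw [map_mul, mul_div_assoc, mul_assoc]
      have := s.tilde.mul_le (IsLocalization.coeSubmodule K I) 1
        (Submodule.mul_mem_mul ⟨i, hi, rfl⟩ (hw b hb))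
      rwa [mul_one] at this
    | add p _ q _ hp hq =>
      rw [map_add, add_div, add_mul]
      exact add_mem hp hq
  -- Because C(r) ⊆ a⁻¹ I C(y₀), the previous step gives x C(r) ⊆ I^⋆̃, and ⋆̃ is idempotent.
  rw [← s.tilde.idem']
  refine ⟨content 𝒜 r, isDense_content hr, fun v hv => ?_⟩
  have := hu _ (hge (Ideal.mul_mem_mul (Ideal.mem_span_singleton_self a) hv))
  rwa [map_mul, mul_div_cancel_left₀ _ haK, mul_comm] at this

/-- Condition 9 for I = R: the finitely generated module G = R[y] satisfies yG ⊆ G, so y lies in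
R^⋆̃_a. -/
theorem mem_tilde_one_of_isIntegral
    (heab : ∀ I : Ideal R, I.IsHomogeneous 𝒜 → I.FG → I ≠ ⊥ →
      s.tilde (IsLocalization.coeSubmodule K I) = s.tilde.eab (IsLocalization.coeSubmodule K I))
    {y : K} (hy : IsIntegral R y) : y ∈ s.tilde 1 := by
  have h := heab ⊤ (Ideal.IsHomogeneous.top 𝒜) (Ideal.fg_top R) top_ne_bot
  rw [IsLocalization.coeSubmodule_top] at h
  rw [h]
  have hone : (1 : Submodule R K) ≠ ⊥ := by
    rw [← IsLocalization.coeSubmodule_top]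
    exact coeSubmodule_ne_bot top_ne_bot
  refine s.tilde.mem_eab_of_forall_mul_mem (G := (Algebra.adjoin R {y}).toSubmodule)
    (by rw [← IsLocalization.coeSubmodule_top]; exact coeSubmodule_fg_of_fg (Ideal.fg_top R)) hone
    hy.fg_adjoin_singleton (fun hbot => ?_) fun z hz => ?_
  · have : (1 : K) ∈ (Algebra.adjoin R {y}).toSubmodule := one_mem (Algebra.adjoin R {y})
    rw [hbot] at this
    simp at this
  · rw [one_mul]
    exact s.tilde.le' _ ((Algebra.adjoin R {y}).mul_mem (Algebra.self_mem_adjoin_singleton R y) hz)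

theorem Dominated.le_tilde
    (heab : ∀ I : Ideal R, I.IsHomogeneous 𝒜 → I.FG → I ≠ ⊥ →
      s.tilde (IsLocalization.coeSubmodule K I) = s.tilde.eab (IsLocalization.coeSubmodule K I))
    {A B : Ideal R} (hB : B.IsHomogeneous 𝒜) (hfg : B.FG) (h0 : B ≠ ⊥)
    (h : Dominated 𝒜 s.tilde A B) :
    IsLocalization.coeSubmodule K A ≤ s.tilde (IsLocalization.coeSubmodule K B) := by
  obtain ⟨H, -, hHfg, hH0, hle⟩ := h
  rw [heab B hB hfg h0]
  intro x hx
  refine s.tilde.mem_eab_of_forall_mul_mem (coeSubmodule_fg_of_fg hfg) (coeSubmodule_ne_bot h0)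
    (coeSubmodule_fg_of_fg hHfg) (coeSubmodule_ne_bot hH0) fun y hy => ?_
  rw [← IsLocalization.coeSubmodule_mul]
  refine hle ?_
  rw [IsLocalization.coeSubmodule_mul]
  exact Submodule.mul_mem_mul hx hy

theorem isNagataInvertible_span_pair (hunit : ∃ α : Γ, α ≠ 0 ∧ ∃ u ∈ 𝒜 α, IsUnit u)
    (heab : ∀ I : Ideal R, I.IsHomogeneous 𝒜 → I.FG → I ≠ ⊥ →
      s.tilde (IsLocalization.coeSubmodule K I) = s.tilde.eab (IsLocalization.coeSubmodule K I))
    {a b : R} (ha : SetLike.IsHomogeneousElem 𝒜 a) (ha0 : a ≠ 0)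
    (hb : SetLike.IsHomogeneousElem 𝒜 b) (hb0 : b ≠ 0) :
    IsNagataInvertible 𝒜 s (Ideal.span {a} ⊔ Ideal.span {b}) := by
  obtain ⟨v, -, hv₁, hv₂⟩ := exists_isUnit_content_add_mul 𝒜 hunit a b
  set W : Ideal R := Ideal.span {a * a, b * b}
  have hW : W.IsHomogeneous 𝒜 := by
    refine Ideal.homogeneous_span 𝒜 _ ?_
    rintro _ (rfl | rfl)
    · exact ha.mul ha
    · exact hb.mul hb
  have hW0 : W ≠ ⊥ := by
    intro h
    have : a * a ∈ W := Ideal.subset_span (by simp)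
    rw [h] at this
    exact mul_ne_zero ha0 ha0 (by simpa using this)
  -- The product (a + bv)(a − bv) = a² − v²b² lies in W = (a², b²), while both factors have content
  -- (a, b). Hence (a, b)² ≺ W, and condition 9 turns this into ab ∈ W^⋆̃.
  have hdom : Dominated 𝒜 s.tilde (content 𝒜 (a + b * v) * content 𝒜 (a - b * v)) W := by
    refine (dominated_content_mul 𝒜 s.tilde _ _).trans (.of_le ((content_le_iff hW).mpr ?_))
    exact Ideal.mem_span_pair.mpr ⟨1, -(v * v), by ring⟩
  have hab : algebraMap R K (a * b) ∈ s.tilde (IsLocalization.coeSubmodule K W) := by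
    refine hdom.le_tilde heab hW (Submodule.fg_span (Set.toFinite _)) hW0 ⟨a * b, ?_, rfl⟩
    refine Ideal.mul_mem_mul ?_ ?_
    · rw [hv₁]; exact Ideal.mem_sup_left (mem_content_self 𝒜 a)
    · rw [hv₂]; exact Ideal.mem_sup_right (mem_content_self 𝒜 b)
  obtain ⟨z, hz, c, hc, hcz⟩ := exists_mul_mem_of_mem_tilde hunit hab
  rw [Algebra.linearMap_apply, ← map_mul] at hcz
  rw [FaithfulSMul.algebraMap_injective R K hcz] at hc
  obtain ⟨l, m, hlm⟩ := Ideal.mem_span_pair.mp hc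
  have haK : algebraMap R K a ≠ 0 := by simpa using ha0
  have hbK : algebraMap R K b ≠ 0 := by simpa using hb0
  -- From la² + mb² = zab, the elements la/b and mb/a have sum z and product lm, so la/b is a root
  -- of X² − zX + lm.
  have hint : IsIntegral R (algebraMap R K (l * a) / algebraMap R K b) := by
    refine ⟨Polynomial.X ^ 2 + (-Polynomial.C z * Polynomial.X + Polynomial.C (l * m)),
      Polynomial.monic_X_pow_add ?_, ?_⟩
    · refine lt_of_le_of_lt (b := 1) ?_ (by norm_num)
      compute_degree
    · have hK := congrArg (algebraMap R K) hlm
      simp only [map_mul, map_add] at hK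
      simp only [Polynomial.eval₂_add, Polynomial.eval₂_pow, Polynomial.eval₂_X,
        Polynomial.eval₂_mul, Polynomial.eval₂_neg, Polynomial.eval₂_C, map_mul]
      field_simp
      linear_combination algebraMap R K l * hK
  obtain ⟨r, hr, hmem⟩ := exists_mul_mem_of_mem_tilde hunit (mem_tilde_one_of_isIntegral heab hint)
  obtain ⟨p, hp⟩ := Submodule.mem_one.mp hmem
  have hp₁ : l * a * r = p * b := by
    refine FaithfulSMul.algebraMap_injective R K ?_
    rw [map_mul, map_mul (algebraMap R K) p, hp]
    field_simp
  have hp₂ : m * b * r = (z * r - p) * a := by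
    refine mul_right_cancel₀ hb0 ?_
    linear_combination r * hlm - a * hp₁
  -- The approximate inverse is (lra, mrb) with denominator ab: `hp₁` and `hp₂` show that a·lra and
  -- b·mrb are multiples of ab, and a·lra + b·mrb = ab·rz.
  refine ⟨a * b, mul_ne_zero ha0 hb0, Ideal.span {l * r * a} ⊔ Ideal.span {m * r * b}, r * z,
    mul_mem hr hz, ?_, ?_⟩
  · rw [Ideal.mul_sup, Ideal.sup_mul, Ideal.sup_mul]
    simp only [Ideal.span_singleton_mul_span_singleton]
    refine sup_le (sup_le ?_ ?_) (sup_le ?_ ?_) <;>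
      rw [Ideal.span_singleton_le_iff_mem, Ideal.mem_span_singleton']
    · exact ⟨p, by linear_combination -a * hp₁⟩
    · exact ⟨l * r, by ring⟩
    · exact ⟨m * r, by ring⟩
    · exact ⟨z * r - p, by linear_combination -b * hp₂⟩
  · have : a * b * (r * z) = a * (l * r * a) + b * (m * r * b) := by
      linear_combination -r * hlm
    rw [this]
    exact add_mem
      (Ideal.mul_mem_mul (Ideal.mem_sup_left (Ideal.mem_span_singleton_self a))
        (Ideal.mem_sup_left (Ideal.mem_span_singleton_self _)))
      (Ideal.mul_mem_mul (Ideal.mem_sup_right (Ideal.mem_span_singleton_self b))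
        (Ideal.mem_sup_right (Ideal.mem_span_singleton_self _)))

theorem isNagataInvertible_span (hunit : ∃ α : Γ, α ≠ 0 ∧ ∃ u ∈ 𝒜 α, IsUnit u)
    (heab : ∀ I : Ideal R, I.IsHomogeneous 𝒜 → I.FG → I ≠ ⊥ →
      s.tilde (IsLocalization.coeSubmodule K I) = s.tilde.eab (IsLocalization.coeSubmodule K I))
    {S : Finset R} (hS : S.Nonempty)
    (hhom : ∀ a ∈ S, SetLike.IsHomogeneousElem 𝒜 a ∧ a ≠ 0) :
    IsNagataInvertible 𝒜 s (Ideal.span (S : Set R)) := by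
  classical
  induction hn : S.card using Nat.strong_induction_on generalizing S with
  | _ n ih =>
  subst hn
  obtain ⟨a, ha⟩ := hS
  obtain ⟨S₁, ha₁, rfl⟩ : ∃ S₁, a ∉ S₁ ∧ insert a S₁ = S :=
    ⟨S.erase a, by simp, Finset.insert_erase ha⟩
  rcases S₁.eq_empty_or_nonempty with rfl | ⟨b, hb⟩
  · simpa using isNagataInvertible_span_singleton (hhom a ha).2
  obtain ⟨S₂, hb₂, rfl⟩ : ∃ S₂, b ∉ S₂ ∧ insert b S₂ = S₁ :=
    ⟨S₁.erase b, by simp, Finset.insert_erase hb⟩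
  have hab := isNagataInvertible_span_pair hunit heab (hhom a ha).1 (hhom a ha).2
    (hhom b (by simp)).1 (hhom b (by simp)).2
  rcases S₂.eq_empty_or_nonempty with rfl | hne
  · simpa [Ideal.span_insert] using hab
  have ha₂ : a ∉ S₂ := fun h => ha₁ (Finset.mem_insert_of_mem h)
  have haS := ih (insert a S₂).card (by
    rw [Finset.card_insert_of_notMem ha₁, Finset.card_insert_of_notMem hb₂,
      Finset.card_insert_of_notMem ha₂]
    exact Nat.lt_succ_self _) (Finset.insert_nonempty _ _)
    (fun c hc => hhom c (by
      rcases Finset.mem_insert.mp hc with rfl | hc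
      · exact ha
      · simp [hc])) rfl
  have hbS := ih (insert b S₂).card (by
    rw [Finset.card_insert_of_notMem ha₁]
    exact Nat.lt_succ_self _) (Finset.insert_nonempty _ _)
    (fun c hc => hhom c (Finset.mem_insert_of_mem hc)) rfl
  simp only [Finset.coe_insert, Ideal.span_insert] at haS hbS ⊢
  generalize Ideal.span {a} = A at *
  generalize Ideal.span {b} = B at *
  generalize Ideal.span (S₂ : Set R) = C at *
  refine IsNagataInvertible.of_mul (I' := A * B + B * C + C * A) ?_
  -- Each factor on the left has fewer generators than A + B + C, so it is invertible up to N by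
  -- induction or by the two-generator case; a factor of an invertible product is invertible. As
  -- polynomials the two sides differ by ABC, which the left side already contains.
  have key : (A ⊔ B) * (A ⊔ C) * (B ⊔ C) = (A ⊔ (B ⊔ C)) * (A * B + B * C + C * A) := by
    simp only [← Ideal.add_eq_sup]
    have h₁ : (A + B) * (A + C) * (B + C) + A * B * C =
        (A + (B + C)) * (A * B + B * C + C * A) := by ring
    have h₂ : A * B * C ≤ (A + B) * (A + C) * (B + C) := by
      rw [mul_right_comm]
      exact Ideal.mul_mono (Ideal.mul_mono le_sup_left le_sup_right) le_sup_left
    rw [← h₁]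
    exact (sup_eq_left.mpr h₂).symm
  rw [← key]
  exact (hab.mul haS).mul hbS

theorem isNagataInvertible_of_tilde_eq_eab (hunit : ∃ α : Γ, α ≠ 0 ∧ ∃ u ∈ 𝒜 α, IsUnit u)
    (heab : ∀ I : Ideal R, I.IsHomogeneous 𝒜 → I.FG → I ≠ ⊥ →
      s.tilde (IsLocalization.coeSubmodule K I) = s.tilde.eab (IsLocalization.coeSubmodule K I))
    {I : Ideal R} (hI : I.IsHomogeneous 𝒜) (hfg : I.FG)
    (h0 : I ≠ ⊥) : IsNagataInvertible 𝒜 s I := by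
  classical
  obtain ⟨f, rfl⟩ := exists_content_eq hunit hI hfg
  have hspan : content 𝒜 f = Ideal.span (((finite_components (𝒜 := 𝒜) f).toFinset.image
      fun α => (DirectSum.decompose 𝒜 f α : R) : Finset R) : Set R) := by
    refine le_antisymm (Ideal.span_le.mpr ?_) (Ideal.span_le.mpr ?_)
    · rintro _ ⟨α, rfl⟩
      by_cases h : DirectSum.decompose 𝒜 f α = 0
      · simp [h]
      · exact Ideal.subset_span (Finset.mem_coe.mpr (Finset.mem_image.mpr
          ⟨α, (Set.Finite.mem_toFinset _).mpr h, rfl⟩))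
    · intro x hx
      obtain ⟨α, -, rfl⟩ := Finset.mem_image.mp (Finset.mem_coe.mp hx)
      exact decompose_mem_content 𝒜 f α
  rw [hspan] at h0 ⊢
  refine isNagataInvertible_span hunit heab ?_ fun a ha => ?_
  · rw [Finset.nonempty_iff_ne_empty]
    intro h
    rw [h] at h0
    simp at h0
  · obtain ⟨α, hα, rfl⟩ := Finset.mem_image.mp ha
    exact ⟨⟨α, SetLike.coe_mem _⟩, by simpa using hα⟩

end GradedDomain

/-! ### Assembly of the equivalences. -/

theorem theorem4p6 {Γ R K : Type*} [AddCancelCommMonoid Γ] [IsAddTorsionFree Γ] [DecidableEq Γ]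
    [CommRing R] [IsDomain R] (𝒜 : Γ → AddSubgroup R) [GradedRing 𝒜]
    [Field K] [Algebra R K] [IsFractionRing R K]
    (hunit : ∃ α : Γ, α ≠ 0 ∧ ∃ u ∈ 𝒜 α, IsUnit u)
    (s : SemistarOperation R K)
    (hs : s.ring < GradedDomain.homogeneousQuotientField 𝒜 K) :
    (∃ Kr : Subalgebra R K, (Kr : Set K) = GradedDomain.kroneckerSet 𝒜 s.tilde ∧
      List.TFAE [
        GradedDomain.IsGradedPStarMD 𝒜 s,
        ∀ A : Ideal (GradedDomain.nagataRing 𝒜 s), ∃ I : Ideal R, I.IsHomogeneous 𝒜 ∧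
          A = I.map (algebraMap R (GradedDomain.nagataRing 𝒜 s)),
        ∀ A : Ideal (GradedDomain.nagataRing 𝒜 s), A.IsPrincipal → ∃ I : Ideal R,
          I.IsHomogeneous 𝒜 ∧ A = I.map (algebraMap R (GradedDomain.nagataRing 𝒜 s)),
        IsPruferDomain (GradedDomain.nagataRing 𝒜 s),
        IsDomain (GradedDomain.nagataRing 𝒜 s) ∧ IsBezout (GradedDomain.nagataRing 𝒜 s),
        GradedDomain.nagataRing 𝒜 s = Kr,
        ∃ S : Submonoid R, IsLocalization S Kr,
        Module.Flat R Kr,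
        ∀ I : Ideal R, I.IsHomogeneous 𝒜 → I.FG → I ≠ ⊥ →
          s.tilde (IsLocalization.coeSubmodule K I) =
            s.tilde.eab (IsLocalization.coeSubmodule K I)]) ∧
    (GradedDomain.IsGradedPStarMD 𝒜 s → IsIntegrallyClosed s.tilde.ring) := by
  have hG (h : GradedDomain.IsGradedPStarMD 𝒜 s) :=
    GradedDomain.map_content_eq_span_of_forall_isNagataInvertible hunit
      ((GradedDomain.isGradedPStarMD_iff hunit).mp h)
  refine ⟨⟨GradedDomain.kroneckerRing 𝒜 s.tilde hunit, rfl, ?_⟩, fun h =>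
    GradedDomain.isIntegrallyClosed_tilde_ring hunit hs.le
      (GradedDomain.isBezout_nagataRing hunit (hG h))⟩
  tfae_have 1 → 2 := fun h A => GradedDomain.exists_isHomogeneous_map_eq (hG h) A
  tfae_have 2 → 3 := fun h A _ => h A
  tfae_have 3 → 5 := fun h => ⟨inferInstance, GradedDomain.isBezout_nagataRing hunit
    (GradedDomain.map_content_eq_span_of_isPrincipal h)⟩
  tfae_have 5 → 4 := fun h => h.2.isPruferDomain
  tfae_have 4 → 1 := fun h => (GradedDomain.isGradedPStarMD_iff hunit).mpr fun _ _ hfg h0 =>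
    GradedDomain.isNagataInvertible_of_isPruferDomain h hfg h0
  tfae_have 1 → 6 := fun h => le_antisymm (GradedDomain.nagataRing_le_kroneckerRing hunit)
    (GradedDomain.kroneckerRing_le_nagataRing hunit (hG h))
  tfae_have 6 → 7 := fun h => h ▸ ⟨GradedDomain.nagataSet 𝒜 s, inferInstance⟩
  tfae_have 7 → 8 := fun ⟨S, _⟩ => IsLocalization.flat _ S
  tfae_have 8 → 1 := fun h => (GradedDomain.isGradedPStarMD_iff hunit).mpr fun _ hI hfg h0 =>
    GradedDomain.isNagataInvertible_of_flat hunit h hI hfg h0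
  tfae_have 1 → 9 := fun h _ hI hfg h0 => GradedDomain.tilde_eq_eab hunit
    (GradedDomain.isBezout_nagataRing hunit (hG h)) hI hfg h0
    ((GradedDomain.isGradedPStarMD_iff hunit).mp h _ hI hfg h0)
  tfae_have 9 → 1 := fun h => (GradedDomain.isGradedPStarMD_iff hunit).mpr fun _ hI hfg h0 =>
    GradedDomain.isNagataInvertible_of_tilde_eq_eab hunit h hI hfg h0
  tfae_finish
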